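/- Let $S,T\in\mathrm{PSL}(2,\mathbb{Z})$ be the classes of $\begin{pmatrix}0&-1\\1&0\end{pmatrix}$ and $\begin{pmatrix}1&1\\0&1\end{pmatrix}$. The dessin of a finite-index subgroup $\bar\Gamma\subset\mathrm{PSL}(2,\mathbb{Z})$ is the hypermap $(E,\sigma,\alpha)$, where $E=\mathrm{PSL}(2,\mathbb{Z})/\bar\Gamma$ is the set of edges and $\sigma$, $\alpha$ are the left multiplications by $ST$ and $S$. Its white vertices, black vertices and faces are the cycles of $\sigma$, $\alpha$ and $\sigma\alpha$ (fixed points included), and the degree of a face is the length of its cycle. The dessin has genus $0$ if the numbers of its vertices, edges and faces satisfy $\#\text{white}+\#\text{black}-\#\text{edges}+\#\text{faces}=2$. A loop is a bivalent black vertex both of whose edges end at the same white vertex. Two dessins are isomorphic if a bijection between their edge sets intertwines $\sigma$ and $\alpha$; this is the case if and only if the subgroups are conjugate in $\mathrm{PSL}(2,\mathbb{Z})$. The symmetry group of a dessin is the group of its automorphisms, i.e. the centralizer of $\{\sigma,\alpha\}$ in the group of permutations of $E$. **Proposition.** Up to isomorphism there are exactly $191$ dessins of torsion-free subgroups of $\mathrm{PSL}(2,\mathbb{Z})$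 of index $24$ and genus $0$. Each of them that has at least one loop has trivial symmetry group, except for those in the following table, which lists the dessins with at least one loop and non-trivial symmetry group according to their number of loops, their symmetry group and their multiset of face degrees; $\times m$ means that exactly $m$ isomorphism classes of dessins have the given symmetry group, number of loops and face degrees (and $m=1$ if nothing is indicated). - $2$ loops, symmetry group $\mathbb{Z}/2$ ($18$ dessins): $[6,6,5,5,1,1]\times 2$, $[6,6,6,4,1,1]$, $[7,7,4,4,1,1]\times 2$, $[8,8,3,3,1,1]\times 3$, $[8,8,4,2,1,1]$, $[9,9,2,2,1,1]\times 4$, $[10,5,5,2,1,1]\times 2$, $[12,4,3,3,1,1]$, $[12,6,2,2,1,1]$, $[16,2,2,2,1,1]$. - $4$ loops, symmetry group $\mathbb{Z}/2$ ($3$ dessins): $[10,10,1,1,1,1]\times 2$, $[18,2,1,1,1,1]$. - $3$ loops, symmetry group $\mathbb{Z}/3$ ($1$ dessin): $[7,7,7,1,1,1]$. - $4$ loops, symmetry group $\mathbb{Z}/2\times\mathbb{Z}/2$ ($1$ dessin): $[10,10,1,1,1,1]$. - $4$ loops, symmetry group $\mathbb{Z}/4$ ($1$ dessin): $[16,4,1,1,1,1]$.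 In particular, among the dessins with at least one loop, exactly $21$ have symmetry group $\mathbb{Z}/2$, and exactly one each has symmetry group $\mathbb{Z}/3$, $(\mathbb{Z}/2)^2$ and $\mathbb{Z}/4$. Moreover, for each of the face degrees $[6,6,6,4,1,1]$, $[8,8,4,2,1,1]$, $[16,2,2,2,1,1]$, $[7,7,7,1,1,1]$ and $[16,4,1,1,1,1]$ there is, up to isomorphism, exactly one torsion-free dessin of index $24$ and genus $0$ with these face degrees. -/

import Mathlib

namespace Dessins

/-- The modular group `PSL(2, ℤ) = SL(2, ℤ) / {±I}`. -/
abbrev PSL2Z : Type := Matrix.ProjectiveSpecialLinearGroup (Fin 2) ℤ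

/-- The projection `SL(2, ℤ) → PSL(2, ℤ)`. -/
def proj : Matrix.SpecialLinearGroup (Fin 2) ℤ →* PSL2Z :=
  QuotientGroup.mk' _

/-- The class of `(0, -1; 1, 0)`, an element of order `2`. -/
def S : PSL2Z := proj ModularGroup.S

/-- The class of `(1, 1; 0, 1)`. The product `S * T` has order `3`. -/
def T : PSL2Z := proj ModularGroup.T

/-- A finite hypermap: a finite set of edges with two permutations that generate a transitive
group. The white vertices are the cycles of `σ`, the black vertices are the cycles of `α` and the
faces are the cycles of `σ * α` (fixed points count as cycles). -/
structure Hypermap where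
  Edge : Type
  [finite : Finite Edge]
  σ : Equiv.Perm Edge
  α : Equiv.Perm Edge
  transitive : ∀ x y : Edge, ∃ g ∈ Subgroup.closure {σ, α}, g x = y

attribute [instance] Hypermap.finite

/-- The cycle lengths of a permutation of a finite set, with a `1` for every fixed point. -/
noncomputable def cycleLengths {E : Type} [Finite E] (f : Equiv.Perm E) : Multiset ℕ :=
  letI := Fintype.ofFinite E
  letI := Classical.decEq E
  f.partition.parts

namespace Hypermap

/-- Two hypermaps are isomorphic if a bijection of the edges intertwines the permutations. -/
def Isomorphic (H K : Hypermap) : Prop :=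
  ∃ ψ : H.Edge ≃ K.Edge, (∀ e, ψ (H.σ e) = K.σ (ψ e)) ∧ (∀ e, ψ (H.α e) = K.α (ψ e))

/-- The symmetry group: all permutations of the edges that commute with `σ` and `α`, that is,
all isomorphisms of the hypermap with itself. -/
def symmetryGroup (H : Hypermap) : Subgroup (Equiv.Perm H.Edge) :=
  Subgroup.centralizer {H.σ, H.α}

/-- The degrees of the faces; the degree of a face is the length of the corresponding cycle,
half the number of edges on its boundary. -/
noncomputable def faceDegrees (H : Hypermap) : Multiset ℕ :=
  cycleLengths (H.σ * H.α)

/-- Genus zero: the surface that carries the hypermap has Euler characteristic `2`,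
`#white + #black - #edges + #faces = 2`. -/
def IsGenusZero (H : Hypermap) : Prop :=
  Multiset.card (cycleLengths H.σ) + Multiset.card (cycleLengths H.α)
    + Multiset.card (cycleLengths (H.σ * H.α)) = Nat.card H.Edge + 2

/-- The loops: bivalent black vertices whose two edges end at the same white vertex. -/
def loops (H : Hypermap) : Set (Quotient (Equiv.Perm.SameCycle.setoid H.α)) :=
  {b | ∃ e : H.Edge, Quotient.mk _ e = b ∧ H.α e ≠ e ∧ H.α (H.α e) = e ∧
    H.σ.SameCycle e (H.α e)}

/-- The number of loops. -/
noncomputable def numLoops (H : Hypermap) : ℕ := H.loops.ncard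

theorem Isomorphic.refl (H : Hypermap) : H.Isomorphic H :=
  ⟨Equiv.refl _, fun _ => rfl, fun _ => rfl⟩

theorem Isomorphic.symm {H K : Hypermap} (h : H.Isomorphic K) : K.Isomorphic H := by
  obtain ⟨ψ, h1, h2⟩ := h
  refine ⟨ψ.symm, fun e => ?_, fun e => ?_⟩
  · rw [Equiv.symm_apply_eq, h1, Equiv.apply_symm_apply]
  · rw [Equiv.symm_apply_eq, h2, Equiv.apply_symm_apply]

theorem Isomorphic.trans {H K L : Hypermap} (h : H.Isomorphic K) (h' : K.Isomorphic L) :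
    H.Isomorphic L := by
  obtain ⟨ψ, h1, h2⟩ := h
  obtain ⟨φ, h3, h4⟩ := h'
  exact ⟨ψ.trans φ, fun e => by simp [h1, h3], fun e => by simp [h2, h4]⟩

theorem cycleLengths_congr {E F : Type} [Finite E] [Finite F] (ψ : E ≃ F)
    (f : Equiv.Perm E) (g : Equiv.Perm F) (h : ∀ e, ψ (f e) = g (ψ e)) :
    cycleLengths f = cycleLengths g := by
  have hg : g = ψ.permCongr f := by
    ext x
    simp [Equiv.permCongr_apply, h]
  subst hg
  unfold cycleLengths
  let _ := Fintype.ofFinite E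
  let _ := Fintype.ofFinite F
  let _ := Classical.decEq E
  let _ := Classical.decEq F
  have hc : Fintype.card E = Fintype.card F := Fintype.card_congr ψ
  have hct : (ψ.permCongr f).cycleType = f.cycleType := by
    have hψ : ψ.permCongr f
        = f.extendDomain (ψ.trans (Equiv.Set.univ F).symm : E ≃ {x // x ∈ Set.univ}) := by
      ext x
      rw [Equiv.Perm.extendDomain_apply_subtype _ _ (Set.mem_univ x)]
      simp [Equiv.permCongr_apply]
    rw [hψ, Equiv.Perm.cycleType_extendDomain]
  simp only [Equiv.Perm.parts_partition]
  rw [← Equiv.Perm.sum_cycleType, ← Equiv.Perm.sum_cycleType, hct, hc]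

theorem Isomorphic.faceDegrees_eq {H K : Hypermap} (h : H.Isomorphic K) :
    H.faceDegrees = K.faceDegrees := by
  obtain ⟨ψ, h1, h2⟩ := h
  exact cycleLengths_congr ψ _ _ fun e => by simp [h1, h2]

theorem sameCycle_of_intertwines {E F : Type} (ψ : E ≃ F)
    {f : Equiv.Perm E} {g : Equiv.Perm F} (h : ∀ e, ψ (f e) = g (ψ e)) {x y : E}
    (hxy : f.SameCycle x y) : g.SameCycle (ψ x) (ψ y) := by
  have hg : g = ψ.permCongr f := by
    ext x
    simp [Equiv.permCongr_apply, h]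
  obtain ⟨i, hi⟩ := hxy
  refine ⟨i, ?_⟩
  have : (ψ.permCongr f) ^ i = ψ.permCongr (f ^ i) :=
    (map_zpow ψ.permCongrHom f i).symm
  rw [hg, this, Equiv.permCongr_apply, Equiv.symm_apply_apply, hi]

theorem Isomorphic.numLoops_le {H K : Hypermap} (h : H.Isomorphic K) :
    H.numLoops ≤ K.numLoops := by
  obtain ⟨ψ, h1, h2⟩ := h
  let F : Quotient (Equiv.Perm.SameCycle.setoid H.α) →
      Quotient (Equiv.Perm.SameCycle.setoid K.α) :=
    Quotient.map ψ fun _ _ hab => sameCycle_of_intertwines ψ h2 hab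
  refine Set.ncard_le_ncard_of_injOn F ?_ ?_ (Set.toFinite _)
  · rintro _ ⟨e, rfl, he, he', hs⟩
    refine ⟨ψ e, rfl, ?_, ?_, ?_⟩
    · rw [← h2]
      exact fun hh => he (ψ.injective hh)
    · rw [← h2, ← h2, he']
    · rw [← h2]
      exact sameCycle_of_intertwines ψ h1 hs
  · intro a _ b _
    induction a using Quotient.inductionOn
    induction b using Quotient.inductionOn
    intro hab
    have h3 : ∀ e, ψ.symm (K.α e) = H.α (ψ.symm e) := fun e => by
      rw [Equiv.symm_apply_eq, h2, Equiv.apply_symm_apply]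
    have := sameCycle_of_intertwines ψ.symm h3 (Quotient.exact hab)
    simp only [Equiv.symm_apply_apply] at this
    exact Quotient.sound this

theorem Isomorphic.numLoops_eq {H K : Hypermap} (h : H.Isomorphic K) :
    H.numLoops = K.numLoops :=
  le_antisymm h.numLoops_le h.symm.numLoops_le

theorem Isomorphic.symmetryGroup_equiv {H K : Hypermap} (h : H.Isomorphic K) :
    Nonempty (H.symmetryGroup ≃* K.symmetryGroup) := by
  obtain ⟨ψ, h1, h2⟩ := h
  have key : ∀ (f : Equiv.Perm H.Edge) (g : Equiv.Perm K.Edge), (∀ e, ψ (f e) = g (ψ e)) →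
      ψ.permCongrHom f = g := by
    intro f g hfg
    ext x
    simp [Equiv.permCongr_apply, hfg]
  have hmap : H.symmetryGroup.map (ψ.permCongrHom : _ →* Equiv.Perm K.Edge)
      = K.symmetryGroup := by
    ext x
    simp only [symmetryGroup, Subgroup.mem_map, Subgroup.mem_centralizer_iff,
      Set.mem_insert_iff, Set.mem_singleton_iff, forall_eq_or_imp, forall_eq]
    constructor
    · rintro ⟨y, ⟨ha, hb⟩, rfl⟩
      rw [← key _ _ h1, ← key _ _ h2]
      simp only [MonoidHom.coe_coe, ← map_mul, ha, hb, and_self]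
    · rintro ⟨ha, hb⟩
      refine ⟨ψ.permCongrHom.symm x, ⟨?_, ?_⟩, ψ.permCongrHom.apply_symm_apply x⟩
      · apply ψ.permCongrHom.injective
        simp only [map_mul, MulEquiv.apply_symm_apply, key _ _ h1, ha]
      · apply ψ.permCongrHom.injective
        simp only [map_mul, MulEquiv.apply_symm_apply, key _ _ h2, hb]
  exact ⟨(ψ.permCongrHom.subgroupMap H.symmetryGroup).trans (MulEquiv.subgroupCongr hmap)⟩

end Hypermap

theorem closure_S_ST : Subgroup.closure {S * T, S} = (⊤ : Subgroup PSL2Z) := by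
  have h : (Subgroup.closure {ModularGroup.S, ModularGroup.T}).map proj = ⊤ := by
    rw [SpecialLinearGroup.SL2Z_generators, ← MonoidHom.range_eq_map,
      MonoidHom.range_eq_top]
    exact QuotientGroup.mk'_surjective _
  rw [MonoidHom.map_closure, Set.image_pair] at h
  rw [eq_top_iff, ← h, Subgroup.closure_le]
  have hS : S ∈ Subgroup.closure {S * T, S} := Subgroup.subset_closure (by simp)
  have hST : S * T ∈ Subgroup.closure {S * T, S} := Subgroup.subset_closure (by simp)
  rintro x (rfl | rfl)
  · exact hS
  · have := mul_mem (inv_mem hS) hST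
    rwa [inv_mul_cancel_left] at this

/-- The dessin of a modular subgroup `Γ`: the edges are the cosets of `Γ` in `PSL(2, ℤ)`, and
`σ`, `α` are the left multiplications by `S * T`, `S`. -/
def dessin (Γ : Subgroup PSL2Z) [Γ.FiniteIndex] : Hypermap where
  Edge := PSL2Z ⧸ Γ
  σ := MulAction.toPerm (S * T)
  α := MulAction.toPerm S
  transitive := by
    intro x y
    obtain ⟨g, hg⟩ := MulAction.exists_smul_eq PSL2Z x y
    refine ⟨MulAction.toPermHom PSL2Z (PSL2Z ⧸ Γ) g, ?_, hg⟩
    have hmem : g ∈ Subgroup.closure {S * T, S} := by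
      rw [closure_S_ST]
      exact Subgroup.mem_top g
    have := Subgroup.mem_map_of_mem (MulAction.toPermHom PSL2Z (PSL2Z ⧸ Γ)) hmem
    rwa [MonoidHom.map_closure, Set.image_pair] at this

/-- The dessins of two modular subgroups are isomorphic if and only if the subgroups are
conjugate. So isomorphism classes of dessins are the same as conjugacy classes of subgroups. -/
theorem dessin_isomorphic_iff (Γ Δ : Subgroup PSL2Z) [Γ.FiniteIndex] [Δ.FiniteIndex] :
    (dessin Γ).Isomorphic (dessin Δ) ↔
      ∃ a : PSL2Z, Γ = Δ.map (MulAut.conj a).toMonoidHom := by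
  constructor
  · rintro ⟨ψ, h1, h2⟩
    change PSL2Z ⧸ Γ ≃ PSL2Z ⧸ Δ at ψ
    have hψ : ∀ (g : PSL2Z) (x : PSL2Z ⧸ Γ), ψ (g • x) = g • ψ x := by
      intro g
      have hg : g ∈ Subgroup.closure {S * T, S} := by
        rw [closure_S_ST]
        exact Subgroup.mem_top g
      induction hg using Subgroup.closure_induction with
      | mem x hx =>
        rcases hx with rfl | rfl
        · exact h1
        · exact h2
      | one => simp
      | mul x y _ _ hx hy =>
        intro z
        rw [mul_smul, hx, hy, mul_smul]
      | inv x _ hx =>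
        intro z
        rw [eq_inv_smul_iff, ← hx, smul_inv_smul]
    obtain ⟨a, ha⟩ := QuotientGroup.mk_surjective (ψ ((1 : PSL2Z) : PSL2Z ⧸ Γ))
    refine ⟨a, ?_⟩
    ext g
    have e1 : g ∈ Γ ↔ g • ((1 : PSL2Z) : PSL2Z ⧸ Γ) = ((1 : PSL2Z) : PSL2Z ⧸ Γ) := by
      change _ ↔ ((g * 1 : PSL2Z) : PSL2Z ⧸ Γ) = _
      rw [eq_comm, QuotientGroup.eq]
      simp
    rw [e1, ← ψ.injective.eq_iff, hψ, ← ha]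
    change ((g * a : PSL2Z) : PSL2Z ⧸ Δ) = _ ↔ _
    rw [eq_comm, QuotientGroup.eq, Subgroup.mem_map]
    constructor
    · intro h
      exact ⟨_, h, by simp [mul_assoc]⟩
    · rintro ⟨d, hd, rfl⟩
      simpa [mul_assoc] using hd
  · rintro ⟨a, rfl⟩
    have hmem : ∀ g : PSL2Z, g ∈ Δ.map (MulAut.conj a).toMonoidHom ↔ a⁻¹ * g * a ∈ Δ := by
      intro g
      rw [Subgroup.mem_map]
      constructor
      · rintro ⟨d, hd, rfl⟩
        simpa [mul_assoc] using hd
      · intro h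
        exact ⟨_, h, by simp [mul_assoc]⟩
    let f : PSL2Z ⧸ Δ.map (MulAut.conj a).toMonoidHom → PSL2Z ⧸ Δ :=
      Quotient.map' (fun g => g * a) (by
        intro x y hxy
        rw [QuotientGroup.leftRel_apply] at hxy ⊢
        rw [hmem] at hxy
        simpa [mul_assoc] using hxy)
    have hf : Function.Bijective f := by
      constructor
      · intro x y
        induction x using QuotientGroup.induction_on
        induction y using QuotientGroup.induction_on
        rename_i x y
        intro h
        change ((x * a : PSL2Z) : PSL2Z ⧸ Δ) = ((y * a : PSL2Z) : PSL2Z ⧸ Δ) at h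
        rw [QuotientGroup.eq] at h ⊢
        rw [hmem]
        simpa [mul_assoc] using h
      · intro y
        induction y using QuotientGroup.induction_on
        rename_i y
        refine ⟨((y * a⁻¹ : PSL2Z) : PSL2Z ⧸ _), ?_⟩
        change ((y * a⁻¹ * a : PSL2Z) : PSL2Z ⧸ Δ) = _
        simp
    refine ⟨Equiv.ofBijective f hf, fun e => ?_, fun e => ?_⟩
    · induction e using QuotientGroup.induction_on
      rename_i x
      change ((S * T * x * a : PSL2Z) : PSL2Z ⧸ Δ) = ((S * T * (x * a) : PSL2Z) : PSL2Z ⧸ Δ)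
      rw [mul_assoc]
    · induction e using QuotientGroup.induction_on
      rename_i x
      change ((S * x * a : PSL2Z) : PSL2Z ⧸ Δ) = ((S * (x * a) : PSL2Z) : PSL2Z ⧸ Δ)
      rw [mul_assoc]

/-- The torsion-free modular subgroups of index `n` and genus `0`. -/
structure TorsionFreeGenusZero (n : ℕ) where
  group : Subgroup PSL2Z
  [finiteIndex : group.FiniteIndex]
  index_eq : group.index = n
  torsionFree : ∀ g ∈ group, IsOfFinOrder g → g = 1
  genusZero : (dessin group).IsGenusZero

attribute [instance] TorsionFreeGenusZero.finiteIndex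

/-- Two subgroups are identified if their dessins are isomorphic, equivalently if they are
conjugate in `PSL(2, ℤ)`. -/
instance dessinSetoid (n : ℕ) : Setoid (TorsionFreeGenusZero n) where
  r Γ Δ := (dessin Γ.group).Isomorphic (dessin Δ.group)
  iseqv :=
    ⟨fun _ => Hypermap.Isomorphic.refl _, fun h => h.symm, fun h h' => h.trans h'⟩

/-- The dessins, up to isomorphism, of the torsion-free modular subgroups of index `n` and
genus `0`. -/
def DessinClass (n : ℕ) : Type := Quotient (dessinSetoid n)

namespace DessinClass

/-- The face degrees of a dessin. -/
noncomputable def faceDegrees {n : ℕ} (d : DessinClass n) : Multiset ℕ :=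
  Quotient.lift (fun Γ : TorsionFreeGenusZero n => (dessin Γ.group).faceDegrees)
    (fun _ _ h => Hypermap.Isomorphic.faceDegrees_eq h) d

/-- The number of loops of a dessin. -/
noncomputable def numLoops {n : ℕ} (d : DessinClass n) : ℕ :=
  Quotient.lift (fun Γ : TorsionFreeGenusZero n => (dessin Γ.group).numLoops)
    (fun _ _ h => Hypermap.Isomorphic.numLoops_eq h) d

/-- The symmetry group of the dessin is isomorphic to `A`. -/
def HasSymmetry {n : ℕ} (d : DessinClass n) (A : Type) [Group A] : Prop :=
  Quotient.lift
    (fun Γ : TorsionFreeGenusZero n => Nonempty ((dessin Γ.group).symmetryGroup ≃* A))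
    (fun _ _ h => by
      obtain ⟨e⟩ := Hypermap.Isomorphic.symmetryGroup_equiv h
      exact propext ⟨fun ⟨f⟩ => ⟨e.symm.trans f⟩, fun ⟨f⟩ => ⟨e.trans f⟩⟩) d

end DessinClass

/-- The cyclic group of order `m`. -/
abbrev C (m : ℕ) : Type := Multiplicative (ZMod m)

/-- The group `ℤ/2 × ℤ/2`. -/
abbrev V4 : Type := Multiplicative (ZMod 2 × ZMod 2)

/-- The face degrees, with multiplicity, of the dessins with symmetry group `ℤ/2`, according to
the number of loops. -/
def tableC2 : ℕ → Multiset (Multiset ℕ)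
  | 2 => Multiset.replicate 2 {6, 6, 5, 5, 1, 1}
      + Multiset.replicate 1 {6, 6, 6, 4, 1, 1}
      + Multiset.replicate 2 {7, 7, 4, 4, 1, 1}
      + Multiset.replicate 3 {8, 8, 3, 3, 1, 1}
      + Multiset.replicate 1 {8, 8, 4, 2, 1, 1}
      + Multiset.replicate 4 {9, 9, 2, 2, 1, 1}
      + Multiset.replicate 2 {10, 5, 5, 2, 1, 1}
      + Multiset.replicate 1 {12, 4, 3, 3, 1, 1}
      + Multiset.replicate 1 {12, 6, 2, 2, 1, 1}
      + Multiset.replicate 1 {16, 2, 2, 2, 1, 1}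
  | 4 => Multiset.replicate 2 {10, 10, 1, 1, 1, 1}
      + Multiset.replicate 1 {18, 2, 1, 1, 1, 1}
  | _ => 0

/-- The same for the symmetry group `ℤ/3`. -/
def tableC3 : ℕ → Multiset (Multiset ℕ)
  | 3 => {{7, 7, 7, 1, 1, 1}}
  | _ => 0

/-- The same for the symmetry group `ℤ/2 × ℤ/2`. -/
def tableV4 : ℕ → Multiset (Multiset ℕ)
  | 4 => {{10, 10, 1, 1, 1, 1}}
  | _ => 0

/-- The same for the symmetry group `ℤ/4`. -/
def tableC4 : ℕ → Multiset (Multiset ℕ)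
  | 4 => {{16, 4, 1, 1, 1, 1}}
  | _ => 0

/-- The face degrees in the table that belong to a single dessin. -/
def uniqueFaceDegrees : Multiset (Multiset ℕ) :=
  {{6, 6, 6, 4, 1, 1}, {8, 8, 4, 2, 1, 1}, {16, 2, 2, 2, 1, 1}, {7, 7, 7, 1, 1, 1},
    {16, 4, 1, 1, 1, 1}}

end Dessins

/-! ### Codes of hypermaps and the exhaustive search -/

namespace Dessins

/-! The classification reduces to a finite enumeration. If Γ is torsion-free, then `S` and `S * T`
fix no coset, because a fixed coset would put a conjugate of them into Γ. So at index 24 the dessin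
has 8 trivalent white and 12 bivalent black vertices, and since 8 + 12 - 24 + 6 = 2, genus zero
means exactly six faces (`isGenusZero_iff`). Conversely, PSL(2, ℤ) is the free product of the groups
generated by `S` and `S * T` (`exists_hom_of_relations`). Every transitive pair of fixed-point-free
permutations of 24 points with σ³ = α² = 1 therefore comes from an action of PSL(2, ℤ). Its point
stabilizer is torsion-free, because elements of finite order are conjugate into the two factors
(`isConj_of_isOfFinOrder`, `exists_subgroup_of_code`).

Such a map is stored as one number: σ is the fixed rotation x ↦ `rot x`, and the five-bit digits
list the values of the face permutation σα, from which α = σ⁻¹(σα) is recovered. A table of 191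
codes is complete and irredundant for the following reasons.

Completeness: `search` glues black vertices one at a time. The first unmatched edge is joined either
to another unmatched edge or to a new white vertex, and any given map follows one of these branches
(`search_sound`). The root edge may be placed on a shortest face; six faces of total degree 24 force
its degree to be at most 4, which prunes the tree. Every leaf with six faces must be isomorphic to
an entry of the table.

Irredundancy and symmetry: a morphism of connected maps is determined by the image of one edge
(`look_isoCode`), so 24 candidates decide whether two codes are isomorphic. Testing a code against
itself lists its symmetry group. Its order, together with the question whether all squares are
trivial in order 4, identifies the group.

Loops of these maps are faces of degree one (`numLoops_eq_count`), so all invariants can be read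
from the table, and counting classes becomes counting entries (`Rep.bijective_toClass`,
`ncard_classes`). The Boolean procedures are written with recursors and binary `Nat` operations so
that they can be evaluated in the kernel; separate lemmas tie their outcomes to the mathematics. -/

/-- The digit at position `x` of a code: the digits are the five-bit blocks of `c`. -/
def look (c x : ℕ) : ℕ := Nat.land (Nat.shiftRight c (Nat.mul 5 x)) 31

/-- Write the digit `v` at the empty position `x` of `c`. -/
def put (c x v : ℕ) : ℕ := Nat.lor c (Nat.shiftLeft v (Nat.mul 5 x))

/-- The code of the permutation `σ` of the edges `0, …, 23`: the edges at the white vertex `v` are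
`3 * v`, `3 * v + 1`, `3 * v + 2` in this order. -/
def rotCode : ℕ := 903077639307732265342198557984292929

/-- The rotation around the white vertices. -/
def rot (x : ℕ) : ℕ := look rotCode x

/-- Evaluate `n` before it is substituted. -/
def force {β : Type} (n : ℕ) (K : ℕ → β) : β :=
  Nat.rec (K 0) (fun m _ => K (Nat.succ m)) n

/-- `extend c d [v, …] p` is the code of the map of edges that extends `p` from the vertices before
`v` to the listed ones, such that it intertwines the codes `c` and `d` wherever this is needed
to determine it. -/
def extend (c d : ℕ) (l : List ℕ) : ℕ → ℕ :=
  List.rec (fun p => p) (fun v _ ih p =>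
    (fun y => ih (put (put (put p (Nat.mul 3 v) (rot (rot y))) (Nat.succ (Nat.mul 3 v)) y)
      (Nat.succ (Nat.succ (Nat.mul 3 v))) (rot y)))
    (look d (look p (rot (rot (look c (Nat.mul 3 v))))))) l

/-- The code of the only possible isomorphism from `c` to `d` that maps the edge `0` to `r`. -/
def isoCode (c d r : ℕ) : ℕ :=
  extend c d [1, 2, 3, 4, 5, 6, 7] (put (put (put 0 0 r) 1 (rot r)) 2 (rot (rot r)))

/-- All edges. -/
def edges : List ℕ :=
  [0, 1, 2, 3, 4, 5, 6, 7, 8, 9, 10, 11, 12, 13, 14, 15, 16, 17, 18, 19, 20, 21, 22, 23]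

/-- The map `p` of edges intertwines `c` and `d` at all edges of the list. -/
def intertwines (c d p : ℕ) (l : List ℕ) : Bool :=
  List.rec true (fun x _ ih =>
    Bool.rec false ih (Nat.beq (look p (look c x)) (look d (look p x)))) l

/-- There is an isomorphism from `c` to `d` that maps the edge `0` to `r`. -/
def isoTest (c d r : ℕ) : Bool :=
  (fun p => Bool.rec false
      (and (intertwines rotCode rotCode p edges) (and (edges.all fun x => Nat.ble (look p x) 23) (Nat.beq (look p 0) r)))
      (intertwines c d p edges))
    (isoCode c d r)

/-- The `l`-th edge after `x` along its face. -/
def along (d l : ℕ) : ℕ → ℕ :=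
  Nat.rec (fun x => x) (fun _ ih x => ih (look d x)) l

/-- Some code of the list is isomorphic to `d`, by an isomorphism that maps the edge `0` to an edge
at a face of degree `l`. -/
def anyIso (cs : List ℕ) (d l : ℕ) : Bool :=
  edges.any fun r => and (Nat.beq (along d l r) r) (cs.any fun c => isoTest c d r)

/-- The key only selects which codes to compare, and soundness never relies on its being right. A
key that is absent gives `false`, so a missing map makes the search fail. -/
def lookupIso (key d l : ℕ) : List (ℕ × List ℕ) → Bool
  | [] => false
  | (k, cs) :: t => bif Nat.beq k key then anyIso cs d l else lookupIso key d l t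

/-- Walk along the cycle of `x` from `y`, and continue with the length of the cycle and the bit mask
of its elements. -/
def walk {β : Type} (f x : ℕ) (b : β) (K : ℕ → ℕ → β) (n : ℕ) : ℕ → ℕ → ℕ → β :=
  Nat.rec (fun _ _ _ => b) (fun _ ih y len mask =>
    (fun z l m => Bool.rec (ih z l m) (K l m) (Nat.beq z x))
      (look f y) (Nat.succ len) (Nat.lor mask (Nat.shiftLeft 1 y))) n

/-- The check of a complete map: some face is shorter than `l`, or there are at most five faces,
or the map is in the table. -/
def checkFaces (t : List (ℕ × List ℕ)) (f l : ℕ) (xs : List ℕ) : ℕ → ℕ → ℕ → Bool :=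
  List.rec
    (fun cnt mask key =>
      Bool.rec (lookupIso key f l t) (Nat.beq mask 16777215) (Nat.ble cnt 5))
    (fun x _ ih cnt mask key =>
      Bool.rec
        (walk f x false (fun len m =>
          Bool.rec true (ih (Nat.succ cnt) m (Nat.add key (Nat.shiftLeft 1 (Nat.mul 5 len))))
            (Nat.ble l len)) 24 x 0 mask)
        (ih cnt mask key)
        (Nat.beq (Nat.land (Nat.shiftRight mask x) 1) 1)) xs

/-- Accepting `k ≠ 8` is harmless: a map with no open edge and fewer than eight white vertices has
fewer than 24 edges (`PartialMap.eq_eight`). The outer walk finds the degree `l` of the root face,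
against which the other faces are then compared. -/
def checkLeaf (t : List (ℕ × List ℕ)) (k f : ℕ) : Bool :=
  bif Nat.beq k 8 then
    walk f 0 false (fun l _ => checkFaces t f l edges 0 0 0) 24 0 0 0
  else true

/-- The first four steps along the face of the edge `0` are known and do not close the face. -/
def longRootFace (f : ℕ) : Bool :=
  (fun a => Bool.rec
    ((fun b => Bool.rec
      ((fun c => Bool.rec
        (Bool.rec true false (Nat.beq (look f c) 0))
        false (Nat.beq c 0)) (look f b))
      false (Nat.beq b 0)) (look f a))
    false (Nat.beq a 0)) (look f 0)

/-- `g e rest` for all ways to take an element `e` out of the list. -/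
def forallPicks (g : ℕ → List ℕ → Bool) (l : List ℕ) : List ℕ → Bool :=
  List.rec (fun _ => true) (fun e post ih pre =>
    Bool.rec false (ih (pre ++ [e])) (g e (post ++ pre))) l

/-- Explore all maps in which `k` vertices are known, `un` are the known edges whose partner
is not known, and `f` is the code of the known part of the face permutation. -/
def search (t : List (ℕ × List ℕ)) (n : ℕ) : ℕ → List ℕ → ℕ → Bool :=
  Nat.rec (fun _ _ _ => false) (fun _ ih k un f =>
    Bool.rec
      (List.rec (checkLeaf t k f) (fun d rest _ =>
        Bool.rec false
          (Bool.rec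
            (force (put (put f d (Nat.succ (Nat.mul 3 k))) (Nat.mul 3 k) (rot d)) fun f' =>
              ih (Nat.succ k) (Nat.succ (Nat.mul 3 k) :: Nat.succ (Nat.succ (Nat.mul 3 k)) :: rest)
                f')
            true (Nat.beq k 8))
          (forallPicks (fun e un' =>
            force (put (put f d (rot e)) e (rot d)) fun f' => ih k un' f') rest [])) un)
      true (longRootFace f)) n

/-- The digit of a key at position `l` is the number of faces of degree `l`; the codes with these
face degrees follow. For instance 6291456 = 6 · 2 ^ 20 stands for six faces of degree 4. Nothing
here is taken on trust: validity, face degrees, completeness and irredundancy are all checked later.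
-/
def table : List (ℕ × List ℕ) := [
  (6291456, [507007136915425584216854571693157924]),
  (69271552, [635516486737883663332548975742984644]),
  (134219776, [760212223429110423699773728695031236]),
  (1109427200, [635516605580127434729137070925714884]),
  (2147614720, [639410709381869119889335969681285476]),
  (2148598784, [382461218110542391864858549761906212]),
  (2149582848, [764106446073095880256560722633332068]),
  (2181103648, [639410828224112891287049967059928192]),
  (2182087712, [764106446073095880257686624829244544]),
  (2214592576, [983400851590006831732607618913469568, 983400730217561856014255682483192960]),
  (3221228544, [756318000780441409534822125922194980]),
  (3222274112, [983266124177100752630201244865070208]),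
  (34394407936, [639410828224112891285924064864015716]),
  (34395422752, [635516605580127471622625220734551168]),
  (34426882048, [756318002889949154639221470529623492]),
  (34427896864, [764106446076722660177669402766935168, 760212223429110460593261878503867520]),
  (35435578400, [507080148124928670083865834039608448]),
  (35467068448, [768000671363251542209072291728393344, 756318002889949191532709620338459776, 382465023520010869167290888844543104]),
  (35468083264, [983400730221188635934238460420883584]),
  (36507224096, [756318003006080924714005532049998976]),
  (68719544320, [768000671363251542209072255180248324, 382139712684810420825927930234312324]),
  (68721573952, [983400611375237327341498179265823872, 983465776538905309687111275127047296]),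
  (68753064000, [983469579494411170460365815291118720, 983262321225221671776929482638689408]),
  (103079215200, [983033351216585428342703693690373248]),
  (1099514775552, [507080148124928670082739931843695972]),
  (1099514806304, [510901478402779404835137842987467904]),
  (1099546265600, [764106446076722660177669366218790148]),
  (1099546296352, [639410947066356665252778340311434368, 382461218111751317684473181427008640]),
  (1100586421248, [756318003006080924712879629854086500]),
  (1100586452000, [768000671363251429175552051579520128, 760212219208830003572523213687686272]),
  (1100618926112, [756318000781650335354436757587297408]),
  (1100618956864, [983266243019344526595929618116576384, 983469579490784390540383037353428096]),
  (1101659112512, [983148232516541744751672386749793408, 983400494753865140895216407264953472]),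
  (1133871432736, [768000671363126178208477764140467328]),
  (1133872416800, [756317993083217799850404056658936960, 764106446069469104863734370562802816]),
  (1133872447552, [382268379375392969992056247122199680, 983461975691844476839890886635619456]),
  (1133904921664, [983148351358785518717400760001299584, 983400613596108914860944780516459648, 983026538058836716341693749555954816]),
  (1134945108064, [983400488752762094694680053668709504, 983155045674290456752682330884211840]),
  (2199023259648, [751125706147546099150360069418292964]),
  (2199023321152, [983465772318624852666372610310866048, 382146682306574410630709681589388416, 982901157035199026160783353931957376]),
  (2199024305216, [983400492529434551535647632802251904]),
  (35184373236736, [639410947066356665252778303763289348]),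
  (35184405741600, [510759385304589842113260640355288192]),
  (35184406725664, [510974370768829793482568781744112768, 631622264094050352446134298591954048, 382392014536215074101640750112507008]),
  (35184439199776, [760212225649982048112708479754503296]),
  (35185445897248, [768000671363315550057950066957681792, 382139752298891677958096729597346944, 639410709381869121955431911567459456]),
  (35185446912064, [506883503980310770908631192317265024]),
  (35185479386176, [983473384895417388278338241218806912, 756317997004977878513469178453755008, 983461975807976210021186798347158656]),
  (35218731862048, [768000671363251542209135204342236288, 768000671363016383043640254859904128, 768000671363251320559982541014107264]),
  (35218732876864, [756317993291078183936669161247278208, 982904962443458577643601061349491840]),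
  (35218765381728, [983155043689234263406602315453498496]),
  (36283883750464, [768000671363251314971019801493832832, 983461965885113085157585322956096640, 983469579487157615146430783086986368]),
  (70368744179776, [983473384895417388278401153832649856, 982904724759038807900084713659892864, 983148113674297975420054331257324672, 983400375911621371563598351772484736]),
  (1125899907958784, [510974370768829793482568745195967748]),
  (1125899908973600, [253948070135633615398105846515827840]),
  (1125899940432896, [760212225649982048112708443206358276]),
  (1125899941447712, [764106446076722660177732315380778112, 752423780130058965357938969364464768, 503185925481027551427352998181930112]),
  (1125899973952576, [983400851590074383637347949253559424, 756318000781467196223388157234709632]),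
  (1125900980619296, [253955676271341658374626541697041536]),
  (1125900981634112, [764106446069469099274771631042528384, 983473384895417275244818001069933696]),
  (1125901014138976, [983400851590006831732499969920271488, 983400607595005868660408426920215680, 983155045790347337824770227054904448, 983400730213935075031340688696476800]),
  (1125934266584096, [752423780362179806057492696192320640]),
  (1125934266614848, [768000671363251542208964642735195264, 983473384895292024277743713630880896]),
  (1125934267629664, [983400492529251412404599032449664128]),
  (1126999418503264, [983469579487157609557468043566711936]),
  (1161084278932576, [983473384895417388278230592225608832, 983473384895417161040285750984246400]),
  (2251799813685376, [983276740750799489102995950503265408, 983155043681980702503704543729091712, 982911654766538401441649065299346560]),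
  (36028797020079136, [639410947066356665252841252925277312]),
  (36028797021093952, [631622264093867213315085698239366272]),
  (36028797052553248, [768000671363319094113812622068483200]),
  (36028797052584000, [510777726624211894307334140021769344, 639410709381869116366469172047185024]),
  (36028797053568064, [764106446076722660177561753773737088, 760212219648879001912172126158259328, 983465778759776897206557876377683072]),
  (36028797086072928, [983400851589891244506299348900971648]),
  (36028798092739648, [768000671363022615762063957324530816, 982905081285783106316358564566860928, 983473384895481396127216016448095360]),
  (36028798093754464, [983400730221188635934130811427685504, 983266005334856977709620449852327040]),
  (36028831378704448, [983473384895182229112906204350317696, 983473384895417166629248490504520832]),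
  (36028831378735200, [983469579494411170460258166297920640, 983258399431061849682721829817484416, 983400375679317391732996024592041088]),
  (36029896530592864, [983148113674297969831091591737050240, 983400375911621365974635612252210304, 982904724758855668769036113307305088]),
  (36063981391052928, [983155043689234263406494666460300416]),
  (1152921504606915584, [768000671363319094113812585520338180]),
  (1152921504606946336, [253509067119261737171727596162974848]),
  (1152921504607930400, [752423766732750116118491142879773824, 768000671363312010347985045371815040, 510974370768829793482631694357955712]),
  (1152921504607961152, [639410947066356665252670691318236288, 253948064134530569197569492919583872]),
  (1152921504608945216, [503185925481027545838390258661655680]),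
  (1152921504640404512, [760212225649982048112771392368346240]),
  (1152921504640435264, [768000671363135954982764021715895424, 983026775743405018980179626024830080, 752423780129875826226890369011876992, 253955676271158519243577941344453760]),
  (1152921505680590912, [752423780362179800468529956672046208, 752423774361076759856956342596076672]),
  (1152921505680621664, [983266243019344526595821969123378304]),
  (1152921538966586464, [983148351358785518717293111008101504, 983400613596108914860837131523261568]),
  (36893488147419170848, [768000671362903156928513626675938432]),
  (36893488147420185664, [510974370768829793482461132750914688]),
  (36893488147452659776, [760212225649982048112600830761305216, 983473384895484940183078571558896768]),
  (36893488147452690528, [983465772758673851006021522781439104]),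
  (36893488148492846176, [983473384895188461831329906814944384, 982911656991152129932266440114635904]),
  (36893488181778841728, [983400369910518319774099258655966336]),
  (1180591620717411339296, [768000671363319094113875534682326144]),
  (1180591620717411370048, [768000671363312004759022305851540608, 253515642824630760787635471710749824]),
  (1180591620717412354112, [752423766933424718444651296318358656, 760212219648879001912235038772102272]),
  (1180591620717412384864, [502989281336409646663155616939312256]),
  (1180591620717444858976, [983400851590074383637240300260361344, 983473384895301801052029971206308992, 983033351448774042596087501572605056, 752423774361076754267993603075802240]),
  (1180591620718485045376, [983400607595005868660300777927017600, 983155045790347337824662578061706368]),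
  (37778931862957161744448, [768000671363319094113704973075285120, 768000671362909281031367818575152256, 768000671363135954982826934329738368]),
  (37778931862957161775200, [510777726624211894307226491028571264]),
  (37778931862957162759264, [760212219648879001912064477165061248, 983465778759776897206450227384484992]),
  (37778931862957195264128, [983400851589891244506191699907773568, 983276730838893690972558995850593408]),
  (1208925819614629174709312, [983473384895484940183141484172739712]),
  (1208925819614629174740064, [768000671363135954982656372722697344, 983026775743405018980071977031632000, 983473384895477850828288255341954176]),
  (1208925819614629175754880, [983458166855072475608373748900627584]),
  (38685626227668133590599776, [983473384895484940182970922565698688, 983473384895075127100633768065565824]),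
  (38685626227668133590630528, [983465772758673851005913873788241024]),
  (1237940039285380274899125376, [983473384895301801051922322213110912, 983033351448774042595979852579406976, 983276740750867041007736280843355264]),
  (39614081257132168796771975328, [983276740750683901876687680490767488])]

end Dessins

/-! ### The modular group as a free product -/

namespace Dessins

/-! ### Normal forms and conjugacy in a group generated by elements s, u with s² = u³ = 1 -/

section NormalForm

variable {G : Type*} [Group G]

/-- The product of the elements `s * u` and `s * (u * u)` that is described by a list. -/
def word (s u : G) (l : List Bool) : G :=
  (l.map fun b => s * cond b u (u * u)).prod

@[simp] theorem word_nil (s u : G) : word s u [] = 1 := rfl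

@[simp] theorem word_cons (s u : G) (b : Bool) (l : List Bool) :
    word s u (b :: l) = s * cond b u (u * u) * word s u l := by simp [word]

@[simp] theorem word_append (s u : G) (l m : List Bool) :
    word s u (l ++ m) = word s u l * word s u m := by simp [word]

theorem word_pow (s u : G) (l : List Bool) (n : ℕ) :
    word s u l ^ n = word s u (List.replicate n l).flatten := by
  induction n with
  | zero => simp
  | succ n ih => rw [pow_succ', ih, List.replicate_succ, List.flatten_cons, word_append]

theorem map_word {H : Type*} [Group H] (φ : G →* H) (s u : G) (l : List Bool) :
    φ (word s u l) = word (φ s) (φ u) l := by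
  induction l with
  | nil => simp
  | cons b l ih => cases b <;> simp [ih]

variable {s u : G}

/-- The set of products of this shape contains 1 and is stable under left multiplication by `s` and
`u`, hence also by their inverses `s` and `u * u`. -/
theorem exists_normalForm (hs : s * s = 1) (hu : u * (u * u) = 1) {g : G}
    (hg : g ∈ Subgroup.closure {u, s}) :
    ∃ x l y, (x = 1 ∨ x = u ∨ x = u * u) ∧ (y = 1 ∨ y = s) ∧ g = x * word s u l * y := by
  have stepS : ∀ g : G, (∃ x l y, (x = 1 ∨ x = u ∨ x = u * u) ∧ (y = 1 ∨ y = s) ∧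
      g = x * word s u l * y) → ∃ x l y, (x = 1 ∨ x = u ∨ x = u * u) ∧ (y = 1 ∨ y = s) ∧
      s * g = x * word s u l * y := by
    rintro _ ⟨x, l, y, rfl | rfl | rfl, hy, rfl⟩
    · cases l with
      | nil =>
        rcases hy with rfl | rfl
        · exact ⟨1, [], s, by simp, by simp, by simp⟩
        · exact ⟨1, [], 1, by simp, by simp, by simp [hs]⟩
      | cons b l =>
        refine ⟨cond b u (u * u), l, y, by cases b <;> simp, hy, ?_⟩
        simp [← mul_assoc, hs]
    · exact ⟨1, true :: l, y, by simp, hy, by simp [mul_assoc]⟩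
    · exact ⟨1, false :: l, y, by simp, hy, by simp [mul_assoc]⟩
  have stepU : ∀ g : G, (∃ x l y, (x = 1 ∨ x = u ∨ x = u * u) ∧ (y = 1 ∨ y = s) ∧
      g = x * word s u l * y) → ∃ x l y, (x = 1 ∨ x = u ∨ x = u * u) ∧ (y = 1 ∨ y = s) ∧
      u * g = x * word s u l * y := by
    rintro _ ⟨x, l, y, hx, hy, rfl⟩
    rcases hx with hx | hx | hx <;> subst x
    · exact ⟨u, l, y, by simp, hy, by simp [mul_assoc]⟩
    · exact ⟨u * u, l, y, by simp, hy, by simp [mul_assoc]⟩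
    · exact ⟨1, l, y, by simp, hy, by rw [← mul_assoc, ← mul_assoc, hu]⟩
  have hs' : s⁻¹ = s := inv_eq_of_mul_eq_one_left hs
  have hu' : u⁻¹ = u * u := inv_eq_of_mul_eq_one_right hu
  induction hg using Subgroup.closure_induction_left with
  | one => exact ⟨1, [], 1, by simp, by simp, by simp⟩
  | mul_left x hx y _ ih =>
    rcases hx with rfl | rfl
    · exact stepU _ ih
    · exact stepS _ ih
  | inv_mul_cancel x hx y _ ih =>
    rcases hx with rfl | rfl
    · rw [hu', mul_assoc]
      exact stepU _ (stepU _ ih)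
    · rw [hs']
      exact stepS _ ih

theorem isConj_mul_comm (a b : G) : IsConj (a * b) (b * a) :=
  isConj_iff.2 ⟨b, by group⟩

/-- An element is conjugate to `1`, a generator, or a positive word. -/
theorem isConj_cases (hs : s * s = 1) (hu : u * (u * u) = 1) {g : G}
    (hg : g ∈ Subgroup.closure {u, s}) :
    g = 1 ∨ IsConj g s ∨ IsConj g u ∨ IsConj g (u * u) ∨ ∃ l, l ≠ [] ∧ IsConj g (word s u l) := by
  -- A word followed by one stray letter is shortened cyclically. A trailing `s` is conjugated
  -- around to cancel the leading `s`; a trailing power of `u` merges with the last power of `u`,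
  -- giving either a positive word or, when they cancel, a shorter word followed by `s`.
  have short : ∀ n : ℕ, ∀ l : List Bool, l.length = n → ∀ z, (z = s ∨ z = u ∨ z = u * u) →
      IsConj (word s u l * z) s ∨ IsConj (word s u l * z) u ∨ IsConj (word s u l * z) (u * u) ∨
        ∃ m, m ≠ [] ∧ IsConj (word s u l * z) (word s u m) := by
    intro n
    induction n with
    | zero =>
      intro l hl z hz
      obtain rfl := List.length_eq_zero_iff.1 hl
      rw [word_nil, one_mul]
      rcases hz with rfl | rfl | rfl
      · exact Or.inl (IsConj.refl _)
      · exact Or.inr (Or.inl (IsConj.refl _))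
      · exact Or.inr (Or.inr (Or.inl (IsConj.refl _)))
    | succ n ih =>
      intro l hl z hz
      rcases hz with rfl | hz
      · obtain ⟨b, l, rfl⟩ := List.exists_cons_of_length_eq_add_one hl
        have h1 : IsConj (word z u (b :: l) * z) (word z u l * cond b u (u * u)) := by
          have := (isConj_mul_comm z (cond b u (u * u) * word z u l * z)).trans
            (b := cond b u (u * u) * word z u l * z * z) (c := word z u l * cond b u (u * u)) (by
              rw [mul_assoc _ z z, hs, mul_one]
              exact isConj_mul_comm _ _)
          simpa [mul_assoc] using this
        rcases ih l (by simpa using hl) (cond b u (u * u)) (by cases b <;> simp) with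
          h | h | h | ⟨m, hm, h⟩
        · exact Or.inl (h1.trans h)
        · exact Or.inr (Or.inl (h1.trans h))
        · exact Or.inr (Or.inr (Or.inl (h1.trans h)))
        · exact Or.inr (Or.inr (Or.inr ⟨m, hm, h1.trans h⟩))
      · obtain ⟨b, l, rfl⟩ : ∃ b l', l = l' ++ [b] := by
          have hne : l ≠ [] := by
            rintro rfl
            simp at hl
          exact ⟨_, _, (List.dropLast_append_getLast hne).symm⟩
        have hl' : l.length = n := by simpa using hl
        rcases hz with hz | hz <;> subst z <;> cases b
        · simpa [mul_assoc, hu] using ih l hl' s (Or.inl rfl)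
        · exact Or.inr (Or.inr (Or.inr ⟨l ++ [false], by simp, by
            rw [show word s u (l ++ [true]) * u = word s u (l ++ [false]) by simp [mul_assoc]]⟩))
        · refine Or.inr (Or.inr (Or.inr ⟨l ++ [true], by simp, ?_⟩))
          rw [show word s u (l ++ [false]) * (u * u) = word s u (l ++ [true]) by
            simp [mul_assoc, hu]]
        · simpa [mul_assoc, hu] using ih l hl' s (Or.inl rfl)
  obtain ⟨x, l, y, hx, hy, rfl⟩ := exists_normalForm hs hu hg
  have h1 : IsConj (x * word s u l * y) (word s u l * (y * x)) := by
    rw [mul_assoc, ← mul_assoc (word s u l)]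
    exact isConj_mul_comm _ _
  have done : ∀ z, (z = s ∨ z = u ∨ z = u * u) → y * x = z → _ := fun z hz hyx => by
    have := short _ l rfl z hz
    rw [← hyx] at this
    exact this
  have key : y * x = 1 ∨ (∃ b, y * x = s * cond b u (u * u)) ∨
      (y * x = s ∨ y * x = u ∨ y * x = u * u) := by
    rcases hx with rfl | rfl | rfl <;> rcases hy with rfl | rfl
    · simp
    · simp
    · simp
    · exact Or.inr (Or.inl ⟨true, rfl⟩)
    · simp
    · exact Or.inr (Or.inl ⟨false, rfl⟩)
  rcases key with h | ⟨b, h⟩ | h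
  · rw [h, mul_one] at h1
    cases l with
    | nil => exact Or.inl (isConj_one_right.1 (by simpa using h1.symm))
    | cons b l => exact Or.inr (Or.inr (Or.inr (Or.inr ⟨_, by simp, h1⟩)))
  · refine Or.inr (Or.inr (Or.inr (Or.inr ⟨l ++ [b], by simp, ?_⟩)))
    simpa [h] using h1
  · rcases done _ h rfl with h | h | h | ⟨m, hm, h⟩
    · exact Or.inr (Or.inl (h1.trans h))
    · exact Or.inr (Or.inr (Or.inl (h1.trans h)))
    · exact Or.inr (Or.inr (Or.inr (Or.inl (h1.trans h))))
    · exact Or.inr (Or.inr (Or.inr (Or.inr ⟨m, hm, h1.trans h⟩)))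

end NormalForm

/-! ### Presentation and torsion of PSL(2, ℤ) -/

section ModularGroup

open Matrix

theorem proj_eq_one_iff (g : Matrix.SpecialLinearGroup (Fin 2) ℤ) :
    proj g = 1 ↔ g ∈ Subgroup.center (Matrix.SpecialLinearGroup (Fin 2) ℤ) :=
  QuotientGroup.eq_one_iff g

theorem offDiag_eq_zero_of_proj_eq_one {g : Matrix.SpecialLinearGroup (Fin 2) ℤ} (h : proj g = 1) :
    g 0 1 = 0 ∧ g 1 0 = 0 := by
  rw [proj_eq_one_iff, Matrix.SpecialLinearGroup.mem_center_iff] at h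
  obtain ⟨r, -, hr⟩ := h
  constructor
  · have := congrFun (congrFun hr 0) 1
    rw [scalar_apply, diagonal_apply_ne _ (by decide)] at this
    exact this.symm
  · have := congrFun (congrFun hr 1) 0
    rw [scalar_apply, diagonal_apply_ne _ (by decide)] at this
    exact this.symm

theorem S_mul_S : S * S = 1 := by
  rw [S, ← map_mul, proj_eq_one_iff, Matrix.SpecialLinearGroup.mem_center_iff]
  -- The matrix of `S` squares to -I, which is the scalar matrix of -1.
  refine ⟨-1, by norm_num, ?_⟩
  ext i j
  fin_cases i <;> fin_cases j <;> simp [ModularGroup.coe_S]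

theorem ST_cube : S * T * (S * T * (S * T)) = 1 := by
  simp only [S, T, ← map_mul]
  rw [proj_eq_one_iff, Matrix.SpecialLinearGroup.mem_center_iff]
  refine ⟨-1, by norm_num, ?_⟩
  ext i j
  fin_cases i <;> fin_cases j <;> simp [ModularGroup.coe_S, ModularGroup.coe_T]

theorem S_ne_one : S ≠ 1 := fun h => by
  have := (offDiag_eq_zero_of_proj_eq_one h).2
  simp [ModularGroup.S] at this

theorem ST_ne_one : S * T ≠ 1 := fun h => by
  rw [S, T, ← map_mul] at h
  have := (offDiag_eq_zero_of_proj_eq_one h).2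
  simp [ModularGroup.coe_S, ModularGroup.coe_T] at this

/-- A positive word lifts to a matrix with nonnegative entries. -/
theorem exists_lift_word (l : List Bool) : ∃ g : Matrix.SpecialLinearGroup (Fin 2) ℤ,
    proj g = word S (S * T) l ∧ 1 ≤ g 0 0 ∧ 1 ≤ g 1 1 ∧ 0 ≤ g 0 1 ∧ 0 ≤ g 1 0 ∧
      (l.length : ℤ) ≤ g 0 1 + g 1 0 := by
  induction l with
  | nil => exact ⟨1, by simp⟩
  | cons b l ih =>
    obtain ⟨g, hg, h⟩ := ih
    cases b
    -- S(ST)² = TST is the class of (1, 0; 1, 1), which adds the first row of `g` to the second. The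
    -- lower left entry grows by `g 0 0 ≥ 1`.
    · refine ⟨ModularGroup.T * ModularGroup.S * ModularGroup.T * g, ?_, ?_⟩
      · simp only [map_mul, hg, word_cons, cond_false]
        change T * S * T * _ = S * (S * T * (S * T)) * _
        simp [← mul_assoc, S_mul_S]
      · simp [ModularGroup.coe_S, ModularGroup.coe_T, Matrix.mul_apply, Fin.sum_univ_two]
        omega
    -- S(ST) = T adds the second row to the first, so the upper right entry grows by `g 1 1 ≥ 1`.
    · refine ⟨ModularGroup.T * g, ?_, ?_⟩
      · simp only [map_mul, hg, word_cons, cond_true]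
        change T * _ = S * (S * T) * _
        simp [← mul_assoc, S_mul_S]
      · simp [ModularGroup.coe_T, Matrix.mul_apply, Fin.sum_univ_two]
        omega

/-- The off-diagonal entries of the lift have a positive sum, whereas a lift of 1 is a scalar
matrix. -/
theorem word_ne_one {l : List Bool} (hl : l ≠ []) : word S (S * T) l ≠ 1 := by
  intro h
  obtain ⟨g, hg, h1⟩ := exists_lift_word l
  have h2 := offDiag_eq_zero_of_proj_eq_one (hg.trans h)
  have := List.length_pos_iff.2 hl
  omega

/-- `PSL(2, ℤ)` is the free product of the groups of order `2` and `3` that are generated by `S`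
and `S * T`. -/
theorem exists_hom_of_relations {P : Type*} [Group P] (a b : P) (ha : a * a = 1)
    (hb : b * (b * b) = 1) : ∃ φ : PSL2Z →* P, φ S = a ∧ φ (S * T) = b := by
  let s : FreeGroup Bool := FreeGroup.of false
  let u : FreeGroup Bool := FreeGroup.of true
  let rels : Set (FreeGroup Bool) := {s * s, u * (u * u)}
  have lift_rels : ∀ {Q : Type _} [Group Q] (a b : Q), a * a = 1 → b * (b * b) = 1 →
      ∀ r ∈ rels, FreeGroup.lift (fun i : Bool => cond i b a) r = 1 := by
    rintro Q _ a b ha hb r (rfl | rfl) <;> simp [s, u, ha, hb]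
  have lift_rels' : ∀ r ∈ rels, FreeGroup.lift (fun i : Bool => cond i (S * T) S) r = 1 := by
    rintro r (rfl | rfl) <;> simp only [s, u, map_mul, FreeGroup.lift_apply_of, cond]
    · exact S_mul_S
    · exact ST_cube
  let π : PresentedGroup rels →* PSL2Z := PresentedGroup.toGroup lift_rels'
  let ψ : PresentedGroup rels →* P := PresentedGroup.toGroup (lift_rels a b ha hb)
  let s' : PresentedGroup rels := PresentedGroup.of false
  let u' : PresentedGroup rels := PresentedGroup.of true
  have hs' : s' * s' = 1 := PresentedGroup.one_of_mem (x := s * s) (by simp [rels])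
  have hu' : u' * (u' * u') = 1 := PresentedGroup.one_of_mem (x := u * (u * u)) (by simp [rels])
  have πs : π s' = S := PresentedGroup.toGroup.of _
  have πu : π u' = S * T := PresentedGroup.toGroup.of _
  have ψs : ψ s' = a := PresentedGroup.toGroup.of _
  have ψu : ψ u' = b := PresentedGroup.toGroup.of _
  have htop : Subgroup.closure {u', s'} = ⊤ := by
    rw [← PresentedGroup.closure_range_of]
    congr 1
    ext x
    simp [u', s', or_comm]
  have hsurj : Function.Surjective π := by
    rw [← MonoidHom.range_eq_top, MonoidHom.range_eq_map, ← htop, MonoidHom.map_closure,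
      Set.image_pair, πs, πu, closure_S_ST]
  have hinj : Function.Injective π := by
    -- The kernel is normal, so only the conjugacy representatives from `isConj_cases` have to be
    -- excluded.
    rw [injective_iff_map_eq_one]
    intro g hg
    have hconj : ∀ h, IsConj g h → π h = 1 := fun h hh => by
      have := π.map_isConj hh
      rw [hg] at this
      exact isConj_one_right.1 this
    rcases isConj_cases hs' hu' (g := g) (by rw [htop]; trivial) with h | h | h | h | ⟨l, hl, h⟩
    · exact h
    · exact absurd (πs ▸ hconj _ h) S_ne_one
    · exact absurd (πu ▸ hconj _ h) ST_ne_one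
    · have h1 := hconj _ h
      have h2 := congrArg π hu'
      rw [map_mul, h1, mul_one, map_one, πu] at h2
      exact absurd h2 ST_ne_one
    · have h1 := hconj _ h
      rw [map_word, πs, πu] at h1
      exact absurd h1 (word_ne_one hl)
  let e := MulEquiv.ofBijective π ⟨hinj, hsurj⟩
  refine ⟨ψ.comp e.symm.toMonoidHom, ?_, ?_⟩
  · rw [← ψs, ← πs]
    exact congrArg ψ (e.symm_apply_apply s')
  · rw [← ψu, ← πu]
    exact congrArg ψ (e.symm_apply_apply u')

/-- Positive powers of a nonempty positive word are again nonempty positive words, hence nontrivial;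
so such a word has infinite order. -/
theorem isConj_of_isOfFinOrder {g : PSL2Z} (hg : IsOfFinOrder g) :
    g = 1 ∨ IsConj g S ∨ IsConj g (S * T) ∨ IsConj g (S * T * (S * T)) := by
  rcases isConj_cases S_mul_S ST_cube (g := g) (by rw [closure_S_ST]; trivial) with
    h | h | h | h | ⟨l, hl, h⟩
  · exact Or.inl h
  · exact Or.inr (Or.inl h)
  · exact Or.inr (Or.inr (Or.inl h))
  · exact Or.inr (Or.inr (Or.inr h))
  · obtain ⟨n, hn, hn1⟩ := isOfFinOrder_iff_pow_eq_one.1 hg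
    have h1 : IsConj (g ^ n) (word S (S * T) l ^ n) := h.pow n
    rw [hn1, isConj_one_right, word_pow] at h1
    refine absurd h1 (word_ne_one ?_)
    cases n with
    | zero => omega
    | succ n => simp [List.replicate_succ, hl]

end ModularGroup

end Dessins

/-! ### Cycle lengths -/

namespace Dessins

section CycleLengths

open Function hiding mem_support
open Equiv.Perm

variable {E : Type} [Finite E] (f : Equiv.Perm E)

theorem isPeriodicPt_iff_pow {F : Type*} (f : Equiv.Perm F) (n : ℕ) (x : F) :
    IsPeriodicPt f n x ↔ (f ^ n) x = x := by
  rw [IsPeriodicPt, IsFixedPt, Equiv.Perm.iterate_eq_pow]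

theorem minimalPeriod_pos (x : E) : 0 < minimalPeriod f x := by
  apply minimalPeriod_pos_of_mem_periodicPts
  obtain ⟨n, hn, h⟩ := isOfFinOrder_iff_pow_eq_one.1 (isOfFinOrder_of_finite f)
  exact ⟨n, hn, by rw [isPeriodicPt_iff_pow, h]; rfl⟩

theorem card_support_cycleOf [Fintype E] [DecidableEq E] {x : E} (hx : f x ≠ x) :
    (f.cycleOf x).support.card = minimalPeriod f x := by
  have hc : (f.cycleOf x).IsCycle := isCycle_cycleOf f hx
  rw [← hc.orderOf]
  have key : ∀ n, IsPeriodicPt f n x ↔ orderOf (f.cycleOf x) ∣ n := by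
    intro n
    rw [isPeriodicPt_iff_pow, orderOf_dvd_iff_pow_eq_one,
      hc.pow_eq_one_iff' (x := x) (by rwa [cycleOf_apply_self]), cycleOf_pow_apply_self]
  exact Nat.dvd_antisymm ((key _).1 (isPeriodicPt_minimalPeriod f x))
    (((key _).2 dvd_rfl).minimalPeriod_dvd)

/-- There are `l` times as many points of period `l` as cycles of length `l`. -/
theorem count_cycleLengths_mul (l : ℕ) :
    (cycleLengths f).count l * l = Nat.card {x // minimalPeriod f x = l} := by
  classical
  unfold cycleLengths
  let _ := Fintype.ofFinite E
  rw [Nat.card_eq_fintype_card, Fintype.card_subtype]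
  simp only [parts_partition, Multiset.count_add]
  rcases Nat.lt_trichotomy l 1 with h | rfl | h
  · obtain rfl : l = 0 := by omega
    rw [mul_zero, eq_comm, Finset.card_eq_zero, Finset.filter_eq_empty_iff]
    exact fun x _ => (minimalPeriod_pos f x).ne'
  · have h1 : Multiset.count 1 f.cycleType = 0 :=
      Multiset.count_eq_zero.2 fun h => absurd (two_le_of_mem_cycleType h) (by norm_num)
    rw [h1, zero_add, mul_one, Multiset.count_replicate_self, ← Finset.card_compl]
    congr 1
    ext x
    simp [minimalPeriod_eq_one_iff_isFixedPt, IsFixedPt]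
  · have h1 : Multiset.count l (Multiset.replicate (Fintype.card E - f.support.card) 1) = 0 :=
      Multiset.count_eq_zero.2 fun h' => absurd (Multiset.eq_of_mem_replicate h') h.ne'
    rw [h1, add_zero, cycleType, Multiset.count_map, ← Finset.filter_val, Finset.card_val]
    have hmem : ∀ x, minimalPeriod f x = l → f x ≠ x := fun x hx hf => by
      have := minimalPeriod_eq_one_iff_isFixedPt.2 hf
      omega
    -- The points of period `l` are fibred over the cycles of length `l`, and each fibre is the
    -- support of its cycle.
    rw [Finset.card_eq_sum_card_fiberwise (f := fun x => f.cycleOf x)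
      (t := f.cycleFactorsFinset.filter fun c => l = (Finset.card ∘ support) c)]
    · rw [Finset.sum_const_nat (m := l)]
      intro c hc
      rw [Finset.mem_filter] at hc
      have hcl : l = c.support.card := hc.2
      conv_rhs => rw [hcl]
      congr 1
      ext x
      simp only [Finset.mem_filter, Finset.mem_univ, true_and]
      constructor
      · rintro ⟨hx, hxc⟩
        rw [← hxc, mem_support, cycleOf_apply_self]
        exact hmem x hx
      · intro hx
        have h2 := cycle_is_cycleOf hx hc.1
        have h3 : f x ≠ x := mem_support.1 (mem_cycleFactorsFinset_support_le hc.1 hx)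
        refine ⟨?_, h2.symm⟩
        rw [← card_support_cycleOf f h3, ← h2]
        exact hcl.symm
    · intro x hx
      simp only [Finset.coe_filter, Finset.mem_univ, true_and, Set.mem_ofPred_eq] at hx ⊢
      refine ⟨?_, ?_⟩
      · rw [cycleOf_mem_cycleFactorsFinset_iff, mem_support]
        exact hmem x hx
      · rw [comp_apply, card_support_cycleOf f (hmem x hx), hx]

theorem minimalPeriod_eq_card_class (x : E) :
    minimalPeriod f x = Nat.card {y // f.SameCycle x y} := by
  classical
  let _ := Fintype.ofFinite E
  rw [Nat.card_eq_fintype_card, Fintype.card_subtype]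
  by_cases hx : f x = x
  · rw [minimalPeriod_eq_one_iff_isFixedPt.2 hx, eq_comm, Finset.card_eq_one]
    refine ⟨x, ?_⟩
    ext y
    simp only [Finset.mem_filter, Finset.mem_univ, true_and, Finset.mem_singleton]
    constructor
    · rintro ⟨i, rfl⟩
      exact zpow_apply_eq_self_of_apply_eq_self hx i
    · rintro rfl
      exact SameCycle.refl _ _
  · rw [← card_support_cycleOf f hx]
    congr 1
    ext y
    rw [mem_support_cycleOf_iff' hx]
    simp

/-- The number of cycles is the number of classes of the relation to lie in the same cycle. -/
theorem card_cycleLengths :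
    Multiset.card (cycleLengths f) = Nat.card (Quotient (SameCycle.setoid f)) := by
  classical
  let _ := Fintype.ofFinite E
  let size : Quotient (SameCycle.setoid f) → ℕ := fun q => minimalPeriod f q.out
  have hsize : ∀ x : E, size (Quotient.mk _ x) = minimalPeriod f x := by
    intro x
    have h : f.SameCycle (Quotient.mk (SameCycle.setoid f) x).out x :=
      Quotient.exact (s := SameCycle.setoid f) (Quotient.out_eq _)
    change minimalPeriod f _ = _
    rw [minimalPeriod_eq_card_class, minimalPeriod_eq_card_class]
    exact Nat.card_congr (Equiv.subtypeEquivRight fun y => ⟨h.symm.trans, h.trans⟩)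
  have hfib : ∀ q, (Finset.univ.filter fun x : E => Quotient.mk (SameCycle.setoid f) x = q).card
      = size q := by
    intro q
    induction q using Quotient.inductionOn with | h x => ?_
    rw [hsize, minimalPeriod_eq_card_class, Nat.card_eq_fintype_card, Fintype.card_subtype]
    congr 1
    ext y
    simp only [Finset.mem_filter, Finset.mem_univ, true_and]
    rw [Quotient.eq]
    exact sameCycle_comm
  -- Both multisets have, `l` times over, the same count of `l`, namely the number of points of
  -- period `l`. The factor `l` cancels except for `l = 0`, which occurs in neither.
  have hmain : cycleLengths f = Finset.univ.val.map size := by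
    ext l
    have h1 := count_cycleLengths_mul f l
    have h2 : (Finset.univ.val.map size).count l * l = Nat.card {x // minimalPeriod f x = l} := by
      rw [Multiset.count_map, ← Finset.filter_val, Finset.card_val, Nat.card_eq_fintype_card,
        Fintype.card_subtype, Finset.card_eq_sum_card_fiberwise
          (f := fun x => Quotient.mk (SameCycle.setoid f) x)
          (t := Finset.univ.filter fun q => l = size q)]
      · rw [Finset.sum_const_nat (m := l)]
        intro q hq
        rw [Finset.mem_filter] at hq
        conv_rhs => rw [hq.2, ← hfib q]
        rw [Finset.filter_filter]
        congr 1
        ext x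
        simp only [Finset.mem_filter, Finset.mem_univ, true_and, and_iff_right_iff_imp]
        rintro rfl
        rw [← hsize, hq.2]
      · intro x hx
        simp only [Finset.coe_filter, Finset.mem_univ, true_and, Set.mem_ofPred_eq] at hx ⊢
        rw [hsize, hx]
    rcases Nat.eq_zero_or_pos l with rfl | hl
    · rw [Multiset.count_eq_zero.2, Multiset.count_eq_zero.2]
      · intro h
        obtain ⟨q, -, hq⟩ := Multiset.mem_map.1 h
        exact (minimalPeriod_pos f _).ne' hq
      · intro h
        exact absurd (Nat.Partition.parts_pos _ h) (lt_irrefl _)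
    · exact Nat.eq_of_mul_eq_mul_right hl (h1.trans h2.symm)
  rw [hmain, Multiset.card_map, Finset.card_val, Finset.card_univ, Nat.card_eq_fintype_card]

theorem sum_cycleLengths : (cycleLengths f).sum = Nat.card E := by
  unfold cycleLengths
  let _ := Fintype.ofFinite E
  rw [Nat.Partition.parts_sum, Nat.card_eq_fintype_card]

theorem mem_cycleLengths_iff {l : ℕ} : l ∈ cycleLengths f ↔ ∃ x, minimalPeriod f x = l := by
  have h := count_cycleLengths_mul f l
  constructor
  · intro hl
    have hpos : 0 < l := by
      unfold cycleLengths at hl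
      exact Nat.Partition.parts_pos _ hl
    have : Nat.card {x // minimalPeriod f x = l} ≠ 0 := by
      rw [← h]
      exact Nat.mul_ne_zero (Multiset.count_ne_zero.2 hl) hpos.ne'
    obtain ⟨x, hx⟩ := (Nat.card_ne_zero.1 this).1
    exact ⟨x, hx⟩
  · rintro ⟨x, hx⟩
    have : Nat.card {x // minimalPeriod f x = l} ≠ 0 :=
      Nat.card_ne_zero.2 ⟨⟨⟨x, hx⟩⟩, inferInstance⟩
    rw [← h] at this
    exact Multiset.count_ne_zero.1 (left_ne_zero_of_mul this)

/-- A multiset with the right number of points for all periods consists of the cycle lengths. -/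
theorem cycleLengths_eq_of_count {m : Multiset ℕ} (h0 : 0 ∉ m)
    (h : ∀ l, m.count l * l = Nat.card {x // minimalPeriod f x = l}) : cycleLengths f = m := by
  ext l
  rcases Nat.eq_zero_or_pos l with rfl | hl
  · rw [Multiset.count_eq_zero.2 h0, Multiset.count_eq_zero.2]
    intro h
    unfold cycleLengths at h
    exact absurd (Nat.Partition.parts_pos _ h) (lt_irrefl _)
  · exact Nat.eq_of_mul_eq_mul_right hl ((count_cycleLengths_mul f l).trans (h l).symm)

/-- If all points have period `l`, then all cycles have length `l`. -/
theorem card_cycleLengths_mul {l : ℕ} (h : ∀ x, minimalPeriod f x = l) :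
    Multiset.card (cycleLengths f) * l = Nat.card E := by
  have : cycleLengths f = Multiset.replicate (Multiset.card (cycleLengths f)) l := by
    rw [Multiset.eq_replicate]
    refine ⟨rfl, fun b hb => ?_⟩
    obtain ⟨x, rfl⟩ := (mem_cycleLengths_iff f).1 hb
    exact h x
  rw [← sum_cycleLengths f]
  conv_rhs => rw [this]
  rw [Multiset.sum_replicate, smul_eq_mul]

end CycleLengths

end Dessins

/-! ### The hypermap of a code -/

namespace Dessins

theorem testBit_look (c x i : ℕ) :
    (look c x).testBit i = (c.testBit (5 * x + i) && decide (i < 5)) := by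
  change ((c >>> (5 * x)) &&& 31).testBit i = _
  rw [Nat.testBit_and, Nat.testBit_shiftRight, show 31 = 2 ^ 5 - 1 from rfl,
    Nat.testBit_two_pow_sub_one]

theorem look_zero_left (x : ℕ) : look 0 x = 0 := by
  apply Nat.eq_of_testBit_eq
  simp [testBit_look]

/-- Since `put` is a bitwise or, it writes correctly only onto an empty digit, and `v` must fit into
five bits so as not to spill into the next one. -/
theorem look_put {c x v : ℕ} (hv : v < 32) (hc : look c x = 0) (y : ℕ) :
    look (put c x v) y = if y = x then v else look c y := by
  apply Nat.eq_of_testBit_eq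
  intro i
  have hput : ∀ j, (put c x v).testBit j
      = (c.testBit j || (decide (5 * x ≤ j) && v.testBit (j - 5 * x))) := by
    intro j
    change (c ||| v <<< (5 * x)).testBit j = _
    rw [Nat.testBit_or, Nat.testBit_shiftLeft]
  have hbig : ∀ j, 5 ≤ j → v.testBit j = false := fun j hj =>
    Nat.testBit_lt_two_pow (hv.trans_le (Nat.pow_le_pow_right (n := 2) two_pos hj))
  rw [testBit_look, hput]
  by_cases hi : i < 5
  · split_ifs with h
    · subst h
      have := testBit_look c y i
      rw [hc] at this
      simp only [Nat.zero_testBit, hi, decide_true, Bool.and_true] at this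
      simp [← this, hi]
    · rw [testBit_look]
      rcases Nat.lt_or_gt_of_ne h with h | h
      · have : ¬ 5 * x ≤ 5 * y + i := by omega
        simp [this]
      · rw [hbig _ (by omega)]
        simp
  · split_ifs with h
    · simp [hi, hbig i (by omega)]
    · simp [testBit_look, hi]

theorem rot_spec : ∀ x < 24, rot x < 24 ∧ rot (rot (rot x)) = x ∧ rot x ≠ x ∧
    rot (rot x) < 24 ∧ rot x / 3 = x / 3 := by
  decide +kernel

theorem rot_vertex : ∀ v < 8, rot (3 * v) = 3 * v + 1 ∧ rot (3 * v + 1) = 3 * v + 2 ∧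
    rot (3 * v + 2) = 3 * v := by
  decide +kernel

theorem rot_lt {x : ℕ} (hx : x < 24) : rot x < 24 := (rot_spec x hx).1

theorem rot_rot_rot {x : ℕ} (hx : x < 24) : rot (rot (rot x)) = x := (rot_spec x hx).2.1

theorem mem_edges {x : ℕ} : x ∈ edges ↔ x < 24 := by
  change x ∈ List.range 24 ↔ _
  exact List.mem_range

/-- The partner of the edge `x` at the same black vertex. -/
def partner (c x : ℕ) : ℕ := rot (rot (look c x))

/-- The code describes a hypermap in which all white vertices have three edges and all black
vertices have two edges, and the first edge at a white vertex leads to an earlier one. -/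
structure IsCode (c : ℕ) : Prop where
  look_lt : ∀ x < 24, look c x < 24
  partner_partner : ∀ x < 24, partner c (partner c x) = x
  partner_ne : ∀ x < 24, partner c x ≠ x
  partner_lt : ∀ v < 8, 1 ≤ v → partner c (3 * v) < 3 * v

instance (c : ℕ) : Decidable (IsCode c) :=
  decidable_of_iff ((∀ x < 24, look c x < 24) ∧ (∀ x < 24, partner c (partner c x) = x) ∧
      (∀ x < 24, partner c x ≠ x) ∧ ∀ v < 8, 1 ≤ v → partner c (3 * v) < 3 * v)
    ⟨fun ⟨h1, h2, h3, h4⟩ => ⟨h1, h2, h3, h4⟩, fun ⟨h1, h2, h3, h4⟩ => ⟨h1, h2, h3, h4⟩⟩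

namespace IsCode

variable {c : ℕ} (hc : IsCode c)
include hc

theorem partner_lt_card {x : ℕ} (hx : x < 24) : partner c x < 24 :=
  (rot_spec _ (hc.look_lt x hx)).2.2.2.1

theorem rot_partner {x : ℕ} (hx : x < 24) : rot (partner c x) = look c x :=
  rot_rot_rot (hc.look_lt x hx)

end IsCode

/-- The rotation around the white vertices as a permutation. -/
def rotPerm : Equiv.Perm (Fin 24) where
  toFun x := ⟨rot x, rot_lt x.2⟩
  invFun x := ⟨rot (rot x), rot_lt (rot_lt x.2)⟩
  left_inv x := Fin.ext (rot_rot_rot x.2)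
  right_inv x := Fin.ext (rot_rot_rot x.2)

/-- The permutation of the edges that exchanges partners. -/
def partnerPerm {c : ℕ} (hc : IsCode c) : Equiv.Perm (Fin 24) where
  toFun x := ⟨partner c x, hc.partner_lt_card x.2⟩
  invFun x := ⟨partner c x, hc.partner_lt_card x.2⟩
  left_inv x := Fin.ext (hc.partner_partner x x.2)
  right_inv x := Fin.ext (hc.partner_partner x x.2)

/-- The condition `partner_lt` supplies a spanning tree: the first edge at each vertex but the root
leads to an earlier vertex, so strong induction on the vertex reaches every edge. -/
theorem exists_word_of_isCode {c : ℕ} (hc : IsCode c) (x : Fin 24) :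
    ∃ g ∈ Subgroup.closure {rotPerm, partnerPerm hc}, g 0 = x := by
  have hρ : rotPerm ∈ Subgroup.closure {rotPerm, partnerPerm hc} :=
    Subgroup.subset_closure (by simp)
  have hα : partnerPerm hc ∈ Subgroup.closure {rotPerm, partnerPerm hc} :=
    Subgroup.subset_closure (by simp)
  have main : ∀ n, ∀ v < 8, v ≤ n → ∀ x : Fin 24, x.1 / 3 = v →
      ∃ g ∈ Subgroup.closure {rotPerm, partnerPerm hc}, g 0 = x := by
    intro n
    induction n with
    | zero =>
      intro v _ hv x hx
      have h3 : x.1 = 0 ∨ x.1 = 1 ∨ x.1 = 2 := by omega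
      rcases h3 with h | h | h
      · exact ⟨1, one_mem _, Fin.ext h.symm⟩
      · exact ⟨rotPerm, hρ, Fin.ext (by rw [h]; rfl)⟩
      · exact ⟨rotPerm * rotPerm, mul_mem hρ hρ, Fin.ext (by rw [h]; rfl)⟩
    | succ n ih =>
      intro v hv hvn x hx
      rcases Nat.lt_or_ge n v with hlt | hle
      · have hv1 : 1 ≤ v := by omega
        have hp := hc.partner_lt v hv hv1
        obtain ⟨g, hg, hg0⟩ := ih (partner c (3 * v) / 3) (by omega) (by omega)
          ⟨partner c (3 * v), by omega⟩ rfl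
        have h0 : (partnerPerm hc * g) 0 = ⟨3 * v, by omega⟩ := by
          rw [Equiv.Perm.mul_apply, hg0]
          exact Fin.ext (hc.partner_partner _ (by omega))
        have hm := mul_mem hα hg
        obtain ⟨r1, r2, -⟩ := rot_vertex v hv
        have h3 : x.1 = 3 * v ∨ x.1 = 3 * v + 1 ∨ x.1 = 3 * v + 2 := by omega
        rcases h3 with h | h | h
        · exact ⟨_, hm, by rw [h0]; exact Fin.ext h.symm⟩
        · refine ⟨rotPerm * (partnerPerm hc * g), mul_mem hρ hm, ?_⟩
          rw [Equiv.Perm.mul_apply, h0]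
          exact Fin.ext (r1.trans h.symm)
        · refine ⟨rotPerm * (rotPerm * (partnerPerm hc * g)), mul_mem hρ (mul_mem hρ hm), ?_⟩
          rw [Equiv.Perm.mul_apply, Equiv.Perm.mul_apply, h0]
          refine Fin.ext ((congrArg rot r1).trans (r2.trans h.symm))
      · exact ih v hv hle x hx
  exact main (x.1 / 3) (x.1 / 3) (by omega) le_rfl x rfl

/-- The hypermap that is described by a code. -/
def codeHypermap {c : ℕ} (hc : IsCode c) : Hypermap where
  Edge := Fin 24
  σ := rotPerm
  α := partnerPerm hc
  transitive x y := by
    obtain ⟨g, hg, rfl⟩ := exists_word_of_isCode hc x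
    obtain ⟨h, hh, rfl⟩ := exists_word_of_isCode hc y
    exact ⟨h * g⁻¹, mul_mem hh (inv_mem hg), by simp⟩

theorem codeHypermap_face {c : ℕ} (hc : IsCode c) (x : Fin 24) :
    ((codeHypermap hc).σ * (codeHypermap hc).α) x = ⟨look c x, hc.look_lt x x.2⟩ :=
  Fin.ext (hc.rot_partner x.2)

/-! ### Morphisms of connected hypermaps -/

namespace Hypermap

/-- Finiteness gives closure under inverses: an injective map of a finite set into itself is onto.
-/
theorem mem_of_closed (K : Hypermap) {s : Set K.Edge} (hs : s.Nonempty)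
    (hσ : ∀ e ∈ s, K.σ e ∈ s) (hα : ∀ e ∈ s, K.α e ∈ s) (y : K.Edge) : y ∈ s := by
  obtain ⟨e, he⟩ := hs
  obtain ⟨g, hg, rfl⟩ := K.transitive e y
  have : ∀ g ∈ Subgroup.closure {K.σ, K.α}, ∀ e ∈ s, g e ∈ s := by
    intro g hg
    induction hg using Subgroup.closure_induction with
    | mem x hx =>
      rcases hx with rfl | rfl
      · exact hσ
      · exact hα
    | one => exact fun e he => he
    | mul x y _ _ hx hy => exact fun e he => hx _ (hy e he)
    | inv x _ hx =>
      intro e he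
      have hbij := (Set.toFinite s).injOn_iff_bijOn_of_mapsTo (f := x) hx
      obtain ⟨e', he', h'⟩ := (hbij.1 x.injective.injOn).surjOn he
      rw [← h']
      simpa using he'
  exact this g hg e he

/-- A map between hypermaps with the same number of edges that intertwines the rotations and the
face permutations is an isomorphism. -/
theorem exists_equiv_of_intertwines {H K : Hypermap} (ψ : H.Edge → K.Edge) [Nonempty H.Edge]
    (hcard : Nat.card H.Edge = Nat.card K.Edge) (hσ : ∀ e, ψ (H.σ e) = K.σ (ψ e))
    (hf : ∀ e, ψ ((H.σ * H.α) e) = (K.σ * K.α) (ψ e)) :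
    ∃ φ : H.Edge ≃ K.Edge, (∀ e, φ e = ψ e) ∧ (∀ e, φ (H.σ e) = K.σ (φ e)) ∧
      ∀ e, φ (H.α e) = K.α (φ e) := by
  have hα : ∀ e, ψ (H.α e) = K.α (ψ e) := fun e =>
    K.σ.injective ((hσ _).symm.trans (hf e))
  -- The image is nonempty and closed under both permutations, so it is everything by transitivity;
  -- equal cardinalities then give bijectivity.
  have hsurj : Function.Surjective ψ := fun y => by
    refine K.mem_of_closed (s := Set.range ψ) (Set.range_nonempty ψ) ?_ ?_ y
    · rintro _ ⟨e, rfl⟩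
      exact ⟨_, hσ e⟩
    · rintro _ ⟨e, rfl⟩
      exact ⟨_, hα e⟩
  have hbij : Function.Bijective ψ :=
    (Nat.bijective_iff_surjective_and_card ψ).2 ⟨hsurj, hcard⟩
  exact ⟨Equiv.ofBijective ψ hbij, fun _ => rfl, hσ, hα⟩

end Hypermap

/-! ### Computing isomorphisms between codes -/

theorem intertwines_iff {c d p : ℕ} (l : List ℕ) :
    intertwines c d p l = true ↔ ∀ x ∈ l, look p (look c x) = look d (look p x) := by
  induction l with
  | nil => simp [intertwines]
  | cons x l ih =>
    rw [List.forall_mem_cons, ← ih, ← Nat.beq_eq]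
    change (Bool.rec false (intertwines c d p l) (Nat.beq (look p (look c x)) (look d (look p x)))
      : Bool) = true ↔ _
    cases Nat.beq (look p (look c x)) (look d (look p x)) <;> simp

theorem isoTest_iff {c d r : ℕ} : isoTest c d r = true ↔
    (∀ x < 24, look (isoCode c d r) (look c x) = look d (look (isoCode c d r) x)) ∧
    (∀ x < 24, look (isoCode c d r) (rot x) = rot (look (isoCode c d r) x)) ∧
    (∀ x < 24, look (isoCode c d r) x < 24) ∧ look (isoCode c d r) 0 = r := by
  have h1 := intertwines_iff (c := c) (d := d) (p := isoCode c d r) edges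
  have h2 := intertwines_iff (c := rotCode) (d := rotCode) (p := isoCode c d r) edges
  simp only [mem_edges] at h1 h2
  change (Bool.rec false (and (intertwines rotCode rotCode (isoCode c d r) edges)
    (and (edges.all fun x => Nat.ble (look (isoCode c d r) x) 23)
      (Nat.beq (look (isoCode c d r) 0) r)))
    (intertwines c d (isoCode c d r) edges) : Bool) = true ↔ _
  have h3 : (edges.all fun x => Nat.ble (look (isoCode c d r) x) 23) = true ↔
      ∀ x < 24, look (isoCode c d r) x < 24 := by
    simp only [List.all_eq_true, mem_edges, Nat.ble_eq, Nat.lt_succ_iff]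
  rw [← h1, ← h3, ← Nat.beq_eq]
  change _ ↔ _ ∧ (∀ x < 24, look _ (look rotCode x) = look rotCode _) ∧ _
  rw [← h2]
  cases intertwines c d (isoCode c d r) edges <;> simp

theorem extend_cons (c d v p : ℕ) (l : List ℕ) : extend c d (v :: l) p =
    extend c d l (put (put (put p (3 * v)
      (rot (rot (look d (look p (partner c (3 * v))))))) (3 * v + 1)
      (look d (look p (partner c (3 * v))))) (3 * v + 2)
      (rot (look d (look p (partner c (3 * v)))))) := rfl

/-- An isomorphism is determined by the image of the edge `0`, and computed by `isoCode`. -/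
theorem look_isoCode {c d : ℕ} (hc : IsCode c) (ψ : ℕ → ℕ) (hlt : ∀ x < 24, ψ x < 24)
    (hrot : ∀ x < 24, ψ (rot x) = rot (ψ x)) (hlook : ∀ x < 24, ψ (look c x) = look d (ψ x)) :
    ∀ x < 24, look (isoCode c d (ψ 0)) x = ψ x := by
  -- The digits from `3 * v` on are still empty, so the three writes do not interfere.
  have put3 : ∀ (p v a b e : ℕ), a < 24 → b < 24 → e < 24 →
      (∀ x, look p x = if x < 3 * v then ψ x else 0) → ∀ x,
      look (put (put (put p (3 * v) a) (3 * v + 1) b) (3 * v + 2) e) x =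
        if x = 3 * v + 2 then e else if x = 3 * v + 1 then b else if x = 3 * v then a else
          if x < 3 * v then ψ x else 0 := by
    intro p v a b e ha hb he hp x
    have h0 : ∀ x, look (put p (3 * v) a) x = if x = 3 * v then a else
        if x < 3 * v then ψ x else 0 := fun x => by
      rw [look_put (by omega) (by rw [hp, if_neg (by omega)]), hp]
    have h1 : ∀ x, look (put (put p (3 * v) a) (3 * v + 1) b) x = if x = 3 * v + 1 then b else
        if x = 3 * v then a else if x < 3 * v then ψ x else 0 := fun x => by
      rw [look_put (by omega) (by rw [h0, if_neg (by omega), if_neg (by omega)]), h0]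
    rw [look_put (by omega) (by rw [h1, if_neg (by omega), if_neg (by omega), if_neg (by omega)]),
      h1]
  have put3' : ∀ (p v : ℕ), v < 8 → (∀ x, look p x = if x < 3 * v then ψ x else 0) → ∀ x,
      look (put (put (put p (3 * v) (ψ (3 * v))) (3 * v + 1) (ψ (3 * v + 1))) (3 * v + 2)
        (ψ (3 * v + 2))) x = if x < 3 * (v + 1) then ψ x else 0 := by
    intro p v hv hp x
    rw [put3 p v _ _ _ (hlt _ (by omega)) (hlt _ (by omega)) (hlt _ (by omega)) hp]
    split_ifs <;> first | rfl | (congr 1)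
    all_goals omega
  have step : ∀ n v p, v + n = 8 → 1 ≤ v → (∀ x, look p x = if x < 3 * v then ψ x else 0) →
      ∀ x < 24, look (extend c d ((List.range n).map (v + ·)) p) x = ψ x := by
    intro n
    induction n with
    | zero =>
      intro v p hv _ hp x hx
      change look p x = _
      rw [hp, if_pos (by omega)]
    | succ n ih =>
      intro v p hv hv1 hp x hx
      have hv8 : v < 8 := by omega
      obtain ⟨r1, r2, r3⟩ := rot_vertex v hv8
      have hpar := hc.partner_lt v hv8 hv1
      have e1 : look p (partner c (3 * v)) = ψ (partner c (3 * v)) := by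
        rw [hp, if_pos hpar]
      -- The face step from the partner of an edge is the rotation of that edge: σα(αx) = σx. So the
      -- image of the earlier partner determines the images of all three edges at `v`.
      have e2 : look d (ψ (partner c (3 * v))) = ψ (3 * v + 1) := by
        rw [← hlook _ (by omega), ← hc.rot_partner (by omega), hc.partner_partner _ (by omega), r1]
      have e3 : rot (ψ (3 * v + 1)) = ψ (3 * v + 2) := by rw [← hrot _ (by omega), r2]
      have e4 : rot (ψ (3 * v + 2)) = ψ (3 * v) := by rw [← hrot _ (by omega), r3]
      have hl : (List.range (n + 1)).map (v + ·) = v :: (List.range n).map (v + 1 + ·) := by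
        rw [List.range_succ_eq_map, List.map_cons, List.map_map]
        exact congrArg _ (List.map_congr_left fun a _ => by simp only [Function.comp_apply]; omega)
      rw [hl, extend_cons, e1, e2, e3, e4]
      exact ih (v + 1) _ (by omega) (by omega) (put3' p v hv8 hp) x hx
  intro x hx
  have r1 : ψ 1 = rot (ψ 0) := hrot 0 (by omega)
  have r2 : ψ 2 = rot (rot (ψ 0)) := by
    rw [← r1]
    exact hrot 1 (by omega)
  have := step 7 1 (put (put (put 0 0 (ψ 0)) 1 (rot (ψ 0))) 2 (rot (rot (ψ 0)))) rfl le_rfl (by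
    have := put3' 0 0 (by omega) (fun x => by simp [look_zero_left])
    rw [← r2, ← r1]
    exact this) x hx
  exact this

end Dessins

/-! ### Partially explored hypermaps -/

namespace Dessins

open Function Equiv.Perm

/-- The edges `φ 0, φ 1, …` of `H` at the first `k` known white vertices. The partner is known for
the edges that are not in the list `un`, and `f` is the code of the face permutation. -/
structure PartialMap (H : Hypermap) (φ : ℕ → H.Edge) (k : ℕ) (un : List ℕ) (f : ℕ) : Prop where
  pos : 1 ≤ k
  le : k ≤ 8
  inj : ∀ a < 3 * k, ∀ b < 3 * k, φ a = φ b → a = b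
  map_rot : ∀ a < 3 * k, φ (rot a) = H.σ (φ a)
  un_lt : ∀ a ∈ un, a < 3 * k
  nodup : un.Nodup
  known : ∀ a < 3 * k, a ∉ un → ∃ b < 3 * k, b ∉ un ∧ look f a = rot b ∧ φ b = H.α (φ a)
  empty : ∀ a, a ∈ un ∨ 3 * k ≤ a → look f a = 0

theorem rot_lt_mul {k a : ℕ} (hk : k ≤ 8) (ha : a < 3 * k) : rot a < 3 * k := by
  have := (rot_spec a (by omega)).2.2.2.2
  omega

namespace PartialMap

variable {H : Hypermap} {φ : ℕ → H.Edge} {k : ℕ} {un : List ℕ} {f : ℕ}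

theorem map_look (h : PartialMap H φ k un f) {a : ℕ} (ha : a < 3 * k) (hun : a ∉ un) :
    look f a < 3 * k ∧ φ (look f a) = (H.σ * H.α) (φ a) := by
  obtain ⟨b, hb, -, hr, hp⟩ := h.known a ha hun
  rw [hr]
  exact ⟨rot_lt_mul h.le hb, by rw [h.map_rot b hb, hp, Equiv.Perm.mul_apply]⟩

/-- The digit 0 means either "unknown" or "the edge 0"; any other digit is certainly a known value.
-/
theorem map_look_of_ne (h : PartialMap H φ k un f) {a : ℕ} (ha : look f a ≠ 0) :
    look f a < 3 * k ∧ φ (look f a) = (H.σ * H.α) (φ a) := by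
  have h1 := mt (h.empty a) ha
  push Not at h1
  exact h.map_look h1.2 h1.1

/-- Gluing `d` to `e` fixes two face steps at once: σα sends `d` to `rot e` and `e` to `rot d`. -/
theorem match_step (h : PartialMap H φ k un f) (hinv : ∀ e, H.α (H.α e) = e) {d e : ℕ}
    {un' : List ℕ} (hd : d ∈ un) (he : e ∈ un) (hde : d ≠ e) (hφ : φ e = H.α (φ d))
    (hun' : ∀ a, a ∈ un' ↔ a ∈ un ∧ a ≠ d ∧ a ≠ e) (hnd : un'.Nodup) :
    PartialMap H φ k un' (put (put f d (rot e)) e (rot d)) := by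
  have hd3 := h.un_lt d hd
  have he3 := h.un_lt e he
  have hk := h.le
  have l1 : ∀ y, look (put f d (rot e)) y = if y = d then rot e else look f y := fun y =>
    look_put (by have := rot_lt_mul hk he3; omega) (h.empty d (Or.inl hd)) y
  have l2 : ∀ y, look (put (put f d (rot e)) e (rot d)) y = if y = e then rot d else
      if y = d then rot e else look f y := fun y => by
    rw [look_put (by have := rot_lt_mul hk hd3; omega)
      (by rw [l1, if_neg hde.symm]; exact h.empty e (Or.inl he)), l1]
  refine ⟨h.pos, hk, h.inj, h.map_rot, fun a ha => h.un_lt a ((hun' a).1 ha).1, hnd, ?_, ?_⟩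
  · intro a ha hau
    rw [hun'] at hau
    rw [l2]
    by_cases h1 : a = e
    · subst h1
      exact ⟨d, hd3, by simp [hun'], by simp, by rw [hφ, hinv]⟩
    · by_cases h2 : a = d
      · subst h2
        exact ⟨e, he3, by simp [hun'], by simp [h1], hφ⟩
      · rw [if_neg h1, if_neg h2]
        obtain ⟨b, hb, hbu, hb'⟩ := h.known a ha fun h' => hau ⟨h', h2, h1⟩
        exact ⟨b, hb, fun h' => hbu ((hun' b).1 h').1, hb'⟩
  · intro a ha
    have ha' : a ≠ d ∧ a ≠ e := by
      rcases ha with ha | ha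
      · exact ((hun' a).1 ha).2
      · omega
    rw [l2, if_neg ha'.2, if_neg ha'.1]
    exact h.empty a (ha.imp_left fun h' => ((hun' a).1 h').1)

/-- The known edges form whole σ-orbits. If the partner of `d` is not among them, neither are the
other two edges at its white vertex, and the three can be named `3 * k`, `3 * k + 1`, `3 * k + 2`
starting from the partner. -/
theorem vertex_step (h : PartialMap H φ k un f) (hσ : ∀ e, H.σ (H.σ (H.σ e)) = e)
    (hσ' : ∀ e, H.σ e ≠ e) (hinv : ∀ e, H.α (H.α e) = e) (hcard : Nat.card H.Edge = 24) {d : ℕ}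
    {rest : List ℕ} (hun : un = d :: rest) (hφ : ∀ b < 3 * k, φ b ≠ H.α (φ d)) :
    k < 8 ∧ ∃ φ', φ' 0 = φ 0 ∧ PartialMap H φ' (k + 1) ((3 * k + 1) :: (3 * k + 2) :: rest)
      (put (put f d (3 * k + 1)) (3 * k) (rot d)) := by
  subst hun
  have hd3 := h.un_lt d (by simp)
  have hkp := h.pos
  have hrr : ∀ a < 3 * k, φ (rot (rot a)) = H.σ (H.σ (φ a)) := fun a ha => by
    rw [h.map_rot _ (rot_lt_mul h.le ha), h.map_rot a ha]
  set e := H.α (φ d) with he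
  have h1 : ∀ b < 3 * k, φ b ≠ H.σ e := fun b hb hb' => by
    refine hφ (rot (rot b)) (rot_lt_mul h.le (rot_lt_mul h.le hb)) ?_
    rw [hrr b hb, hb', hσ]
  have h2 : ∀ b < 3 * k, φ b ≠ H.σ (H.σ e) := fun b hb hb' => by
    refine hφ (rot b) (rot_lt_mul h.le hb) ?_
    rw [h.map_rot b hb, hb', hσ]
  have h3 : H.σ (H.σ e) ≠ e := fun h' => hσ' e (by rw [← h', hσ, h'])
  let φ' : ℕ → H.Edge := fun a => if a = 3 * k then e else if a = 3 * k + 1 then H.σ e else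
    if a = 3 * k + 2 then H.σ (H.σ e) else φ a
  have v0 : φ' (3 * k) = e := if_pos rfl
  have v1 : φ' (3 * k + 1) = H.σ e := by simp [φ']
  have v2 : φ' (3 * k + 2) = H.σ (H.σ e) := by simp [φ']
  have vold : ∀ a < 3 * k, φ' a = φ a := fun a ha => by
    simp only [φ']
    rw [if_neg (by omega), if_neg (by omega), if_neg (by omega)]
  have cases3 : ∀ a < 3 * (k + 1), a < 3 * k ∨ a = 3 * k ∨ a = 3 * k + 1 ∨ a = 3 * k + 2 := by
    intro a ha
    omega
  have inj' : ∀ a < 3 * (k + 1), ∀ b < 3 * (k + 1), φ' a = φ' b → a = b := by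
    have n01 : e ≠ H.σ e := (hσ' e).symm
    have n12 : H.σ e ≠ H.σ (H.σ e) := (hσ' _).symm
    intro a ha b hb hab
    rcases cases3 a ha with ha | rfl | rfl | rfl <;> rcases cases3 b hb with hb | rfl | rfl | rfl
    · rw [vold a ha, vold b hb] at hab
      exact h.inj a ha b hb hab
    all_goals first
      | rfl
      | rw [vold a ha] at hab
        simp only [v0, v1, v2] at hab
        first
        | exact absurd hab (hφ _ ha)
        | exact absurd hab (h1 _ ha)
        | exact absurd hab (h2 _ ha)
      | rw [vold b hb] at hab
        simp only [v0, v1, v2] at hab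
        first
        | exact absurd hab.symm (hφ _ hb)
        | exact absurd hab.symm (h1 _ hb)
        | exact absurd hab.symm (h2 _ hb)
      | simp only [v0, v1, v2] at hab
        first
        | exact absurd hab n01
        | exact absurd hab n12
        | exact absurd hab h3
        | exact absurd hab.symm n01
        | exact absurd hab.symm n12
        | exact absurd hab.symm h3
  -- The extended naming is injective, so `3 * (k + 1) ≤ 24`.
  have hk8 : k < 8 := by
    have hle : Nat.card (Fin (3 * (k + 1))) ≤ Nat.card H.Edge :=
      Nat.card_le_card_of_injective (fun a : Fin (3 * (k + 1)) => φ' a)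
        fun a b hab => Fin.ext (inj' a a.2 b b.2 hab)
    rw [hcard, Nat.card_fin] at hle
    omega
  obtain ⟨r0, r1, r2⟩ := rot_vertex k hk8
  have hrd := rot_lt_mul h.le hd3
  have l1 : ∀ y, look (put f d (3 * k + 1)) y = if y = d then 3 * k + 1 else look f y := fun y =>
    look_put (by omega) (h.empty d (by simp)) y
  have l2 : ∀ y, look (put (put f d (3 * k + 1)) (3 * k) (rot d)) y = if y = 3 * k then rot d else
      if y = d then 3 * k + 1 else look f y := fun y => by
    rw [look_put (by omega) (by rw [l1, if_neg (by omega)]; exact h.empty _ (by simp)), l1]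
  have hnd := h.nodup
  rw [List.nodup_cons] at hnd
  have hrest : ∀ a ∈ rest, a < 3 * k := fun a ha => h.un_lt a (by simp [ha])
  refine ⟨hk8, φ', vold 0 (by omega), by omega, by omega, inj', ?_, ?_, ?_, ?_, ?_⟩
  · intro a ha
    rcases cases3 a ha with ha | rfl | rfl | rfl
    · rw [vold a ha, vold _ (rot_lt_mul h.le ha), h.map_rot a ha]
    · rw [r0, v0, v1]
    · rw [r1, v1, v2]
    · rw [r2, v0, v2, hσ]
  · intro a ha
    simp only [List.mem_cons] at ha
    rcases ha with rfl | rfl | ha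
    · omega
    · omega
    · have := hrest a ha
      omega
  · simp only [List.nodup_cons, List.mem_cons, not_or]
    refine ⟨⟨by omega, fun h' => ?_⟩, fun h' => ?_, hnd.2⟩
    · have := hrest _ h'
      omega
    · have := hrest _ h'
      omega
  · intro a ha hau
    simp only [List.mem_cons, not_or] at hau
    rw [l2]
    have hdrest : d ∉ (3 * k + 1) :: (3 * k + 2) :: rest := by
      simp only [List.mem_cons, not_or]
      exact ⟨by omega, by omega, hnd.1⟩
    have h0rest : 3 * k ∉ (3 * k + 1) :: (3 * k + 2) :: rest := by
      simp only [List.mem_cons, not_or]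
      refine ⟨by omega, by omega, fun h' => ?_⟩
      have := hrest _ h'
      omega
    rcases cases3 a ha with ha | rfl | rfl | rfl
    · rw [if_neg (by omega)]
      by_cases had : a = d
      · subst had
        exact ⟨3 * k, by omega, h0rest, by simp [r0], by rw [v0, vold a ha]⟩
      · rw [if_neg had]
        obtain ⟨b, hb, hbu, hb1, hb2⟩ := h.known a ha (by simp [had, hau.2.2])
        simp only [List.mem_cons, not_or] at hbu
        refine ⟨b, by omega, ?_, hb1, by rw [vold b hb, vold a ha, hb2]⟩
        simp only [List.mem_cons, not_or]
        exact ⟨by omega, by omega, hbu.2⟩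
    · exact ⟨d, by omega, hdrest, by simp, by rw [v0, vold d hd3, he, hinv]⟩
    · exact absurd rfl hau.1
    · exact absurd rfl hau.2.1
  · intro a ha
    have ha' : a ≠ 3 * k ∧ a ≠ d ∧ (a ∈ d :: rest ∨ 3 * k ≤ a) := by
      simp only [List.mem_cons] at ha ⊢
      rcases ha with (rfl | rfl | ha) | ha
      · omega
      · omega
      · have := hrest a ha
        exact ⟨by omega, fun h' => hnd.1 (h' ▸ ha), Or.inl (Or.inr ha)⟩
      · omega
    rw [l2, if_neg ha'.1, if_neg ha'.2.1]
    exact h.empty a ha'.2.2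

/-- With no open edge left, the known edges are closed under σ and α, so by transitivity they are
all 24 edges. -/
theorem eq_eight (h : PartialMap H φ k [] f) (hcard : Nat.card H.Edge = 24) : k = 8 := by
  have hsurj : ∀ y, ∃ a : Fin (3 * k), φ a = y := by
    have hpos := h.pos
    refine H.mem_of_closed (s := {y | ∃ a : Fin (3 * k), φ a = y}) ⟨_, ⟨0, by omega⟩, rfl⟩ ?_ ?_
    · rintro _ ⟨a, rfl⟩
      exact ⟨⟨_, rot_lt_mul h.le a.2⟩, h.map_rot a a.2⟩
    · rintro _ ⟨a, rfl⟩
      obtain ⟨b, hb, -, -, hb'⟩ := h.known a a.2 (by simp)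
      exact ⟨⟨b, hb⟩, hb'⟩
  have hle := Nat.card_le_card_of_surjective (fun a : Fin (3 * k) => φ a) hsurj
  rw [hcard, Nat.card_fin] at hle
  have := h.le
  omega

/-- Four nonzero digits along the face are four genuine steps none of which returns to the root, so
the period would exceed 4. The double meaning of 0 is harmless, since a zero digit only prevents
pruning. -/
theorem longRootFace_eq_false (h : PartialMap H φ k un f)
    (hroot : minimalPeriod (H.σ * H.α) (φ 0) ≤ 4) : longRootFace f = false := by
  by_contra hne
  rw [Bool.not_eq_false] at hne
  have key : look f 0 ≠ 0 ∧ look f (look f 0) ≠ 0 ∧ look f (look f (look f 0)) ≠ 0 ∧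
      look f (look f (look f (look f 0))) ≠ 0 := by
    change (Bool.rec (Bool.rec (Bool.rec
      (Bool.rec true false (Nat.beq (look f (look f (look f (look f 0)))) 0)) false
        (Nat.beq (look f (look f (look f 0))) 0)) false (Nat.beq (look f (look f 0)) 0)) false
        (Nat.beq (look f 0) 0) : Bool) = true at hne
    have hb : ∀ a, Nat.beq a 0 = false → a ≠ 0 := by
      rintro _ ha rfl
      exact Bool.noConfusion ha
    suffices h : Nat.beq (look f 0) 0 = false ∧ Nat.beq (look f (look f 0)) 0 = false ∧
        Nat.beq (look f (look f (look f 0))) 0 = false ∧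
        Nat.beq (look f (look f (look f (look f 0)))) 0 = false from
      ⟨hb _ h.1, hb _ h.2.1, hb _ h.2.2.1, hb _ h.2.2.2⟩
    revert hne
    generalize Nat.beq (look f 0) 0 = b1
    generalize Nat.beq (look f (look f 0)) 0 = b2
    generalize Nat.beq (look f (look f (look f 0))) 0 = b3
    generalize Nat.beq (look f (look f (look f (look f 0)))) 0 = b4
    cases b1 <;> cases b2 <;> cases b3 <;> cases b4 <;> simp
  have hpos := h.pos
  have hz : ∀ {a : ℕ}, a < 3 * k → a ≠ 0 → φ a ≠ φ 0 := fun ha hne he =>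
    hne (h.inj _ ha 0 (by omega) he)
  obtain ⟨n1, n2, n3, n4⟩ := key
  obtain ⟨i1, e1⟩ := h.map_look_of_ne n1
  obtain ⟨i2, e2⟩ := h.map_look_of_ne n2
  obtain ⟨i3, e3⟩ := h.map_look_of_ne n3
  obtain ⟨i4, e4⟩ := h.map_look_of_ne n4
  have p1 := hz i1 n1
  have p2 := hz i2 n2
  have p3 := hz i3 n3
  have p4 := hz i4 n4
  rw [e1] at e2
  rw [e2] at e3
  rw [e3] at e4
  rw [e1] at p1
  rw [e2] at p2
  rw [e3] at p3
  rw [e4] at p4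
  have hper := isPeriodicPt_minimalPeriod (H.σ * H.α) (φ 0)
  have hpp := minimalPeriod_pos (H.σ * H.α) (φ 0)
  generalize minimalPeriod (H.σ * H.α) (φ 0) = m at *
  interval_cases m
  · exact p1 hper
  · exact p2 hper
  · exact p3 hper
  · exact p4 hper

end PartialMap

end Dessins

/-! ### Soundness of the search -/

namespace Dessins

open Function Equiv.Perm

theorem walk_succ {β : Type} (f x : ℕ) (b : β) (K : ℕ → ℕ → β) (n y len mask : ℕ) :
    walk f x b K (n + 1) y len mask =
      if look f y = x then K (len + 1) (mask ||| 1 <<< y)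
      else walk f x b K n (look f y) (len + 1) (mask ||| 1 <<< y) := by
  change (Bool.rec (walk f x b K n (look f y) (len + 1) (mask ||| 1 <<< y))
    (K (len + 1) (mask ||| 1 <<< y)) (Nat.beq (look f y) x) : β) = _
  split_ifs with h
  · rw [h, Nat.beq_refl]
  · cases hb : Nat.beq (look f y) x
    · rfl
    · exact absurd (Nat.eq_of_beq_eq_true hb) h

/-- The edges `φ 0, …, φ 23` are all edges of a map, and `f` is the code of the permutation `F`. -/
structure Frame {E : Type} (F : Equiv.Perm E) (φ : ℕ → E) (f : ℕ) : Prop where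
  look_lt : ∀ a < 24, look f a < 24
  map_look : ∀ a < 24, φ (look f a) = F (φ a)
  inj : ∀ a < 24, ∀ b < 24, φ a = φ b → a = b
  surj : ∀ e, ∃ a < 24, φ a = e

namespace Frame

variable {E : Type} {F : Equiv.Perm E} {φ : ℕ → E} {f : ℕ}

/-- A walk either runs out of fuel, or stops when it comes back for the first time. -/
theorem walk_eq (h : Frame F φ f) {β : Type} {x : ℕ} (hx : x < 24) (b : β) (K : ℕ → ℕ → β)
    (n y len mask : ℕ) (hy : y < 24) (hF : φ y = (F ^ len) (φ x)) :
    walk f x b K n y len mask = b ∨ ∃ l m, walk f x b K n y len mask = K l m ∧ len < l ∧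
      (F ^ l) (φ x) = φ x ∧ (∀ j, len < j → j < l → (F ^ j) (φ x) ≠ φ x) ∧
      ∀ d, m.testBit d → mask.testBit d ∨ F.SameCycle (φ x) (φ d) := by
  induction n generalizing y len mask with
  | zero => exact Or.inl rfl
  | succ n ih =>
    have hF' : φ (look f y) = (F ^ (len + 1)) (φ x) := by
      rw [h.map_look y hy, hF, pow_succ', Equiv.Perm.mul_apply]
    have hbit : ∀ d, (mask ||| 1 <<< y).testBit d → mask.testBit d ∨ F.SameCycle (φ x) (φ d) := by
      intro d hd
      rw [Nat.testBit_or, Bool.or_eq_true] at hd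
      refine hd.imp_right fun hd => ?_
      rw [Nat.one_shiftLeft, Nat.testBit_two_pow, decide_eq_true_eq] at hd
      subst hd
      exact ⟨len, by rw [hF, zpow_natCast]⟩
    rw [walk_succ]
    split_ifs with hxy
    · refine Or.inr ⟨len + 1, _, rfl, by omega, by rw [← hF', hxy], fun j h1 h2 => by omega, hbit⟩
    · rcases ih (look f y) (len + 1) (mask ||| 1 <<< y) (h.look_lt y hy) hF' with hb |
        ⟨l, m, e, hl, hp, hmin, hm⟩
      · exact Or.inl hb
      · refine Or.inr ⟨l, m, e, by omega, hp, fun j h1 h2 => ?_, fun d hd => ?_⟩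
        · rcases Nat.lt_or_ge (len + 1) j with h3 | h3
          · exact hmin j h3 h2
          · obtain rfl : j = len + 1 := by omega
            rw [← hF']
            exact fun h' => hxy (h.inj _ (h.look_lt y hy) _ hx h')
        · rcases hm d hd with h' | h'
          · exact hbit d h'
          · exact Or.inr h'

theorem minimalPeriod_eq {x : E} {l : ℕ} (hl : 0 < l) (hp : (F ^ l) x = x)
    (hmin : ∀ j, 0 < j → j < l → (F ^ j) x ≠ x) : minimalPeriod F x = l := by
  have h1 := (isPeriodicPt_iff_pow F l x).2 hp
  refine le_antisymm (h1.minimalPeriod_le hl) ?_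
  by_contra hlt
  push Not at hlt
  exact hmin _ (h1.minimalPeriod_pos hl) hlt
    ((isPeriodicPt_iff_pow F _ x).1 (isPeriodicPt_minimalPeriod F x))

end Frame

theorem lookupIso_sound {key d l : ℕ} {t : List (ℕ × List ℕ)} (h : lookupIso key d l t = true) :
    ∃ q ∈ t, ∃ c ∈ q.2, ∃ r, isoTest c d r = true := by
  induction t with
  | nil => exact absurd h (by simp [lookupIso])
  | cons q t ih =>
    rw [lookupIso] at h
    cases hk : Nat.beq q.1 key
    · rw [hk, cond_false] at h
      obtain ⟨q', hq', h'⟩ := ih h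
      exact ⟨q', List.mem_cons_of_mem _ hq', h'⟩
    · rw [hk, cond_true, anyIso, List.any_eq_true] at h
      obtain ⟨r, -, h⟩ := h
      rw [Bool.and_eq_true, List.any_eq_true] at h
      obtain ⟨-, c, hc, h⟩ := h
      exact ⟨q, List.mem_cons_self, c, hc, r, h⟩

theorem checkFaces_cons (t : List (ℕ × List ℕ)) (f l x : ℕ) (xs : List ℕ) (cnt mask key : ℕ) :
    checkFaces t f l (x :: xs) cnt mask key =
      bif Nat.beq (Nat.land (Nat.shiftRight mask x) 1) 1 then checkFaces t f l xs cnt mask key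
      else walk f x false (fun len m => bif Nat.ble l len then
        checkFaces t f l xs (cnt + 1) m (Nat.add key (Nat.shiftLeft 1 (Nat.mul 5 len)))
        else true) 24 x 0 mask := by
  change (Bool.rec _ _ _ : Bool) = _
  cases Nat.beq (Nat.land (Nat.shiftRight mask x) 1) 1
  · simp only [cond_false]
    congr 1
    funext len m
    cases Nat.ble l len <;> rfl
  · rfl

/-- The list `X` holds one edge for each face walked so far, and every marked edge lies on one of
these faces. If all edges are marked after at most five walks, there are at most five faces,
contrary to `hcyc`; a face shorter than `l` contradicts `hmin`. Only a successful lookup in the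
table remains. -/
theorem checkFaces_sound {E : Type} [Finite E] {F : Equiv.Perm E} {φ : ℕ → E} {f : ℕ}
    (h : Frame F φ f) {t : List (ℕ × List ℕ)} {l : ℕ}
    (hmin : ∀ e, l ≤ minimalPeriod F e) (hcyc : 6 ≤ Nat.card (Quotient (SameCycle.setoid F)))
    (xs : List ℕ) (hxs : ∀ x ∈ xs, x < 24) (cnt mask key : ℕ) (X : List E)
    (hX : X.length = cnt) (hmask : ∀ d, mask.testBit d → ∃ x ∈ X, F.SameCycle x (φ d))
    (hcheck : checkFaces t f l xs cnt mask key = true) :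
    ∃ q ∈ t, ∃ c ∈ q.2, ∃ r, isoTest c f r = true := by
  induction xs generalizing cnt mask key X with
  | nil =>
    change (Bool.rec (lookupIso key f l t) (Nat.beq mask 16777215) (Nat.ble cnt 5) : Bool) = true
      at hcheck
    cases hb : Nat.ble cnt 5 <;> rw [hb] at hcheck
    · exact lookupIso_sound hcheck
    · exfalso
      obtain rfl := Nat.eq_of_beq_eq_true hcheck
      have hall : ∀ d < 24, Nat.testBit 16777215 d := by decide
      have hsurj : Surjective fun i : Fin X.length => Quotient.mk (SameCycle.setoid F) (X.get i) := by
        intro q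
        induction q using Quotient.inductionOn with | h e => ?_
        obtain ⟨a, ha, rfl⟩ := h.surj e
        obtain ⟨x, hx, hs⟩ := hmask a (hall a ha)
        obtain ⟨i, rfl⟩ := List.get_of_mem hx
        exact ⟨i, Quotient.sound (s := SameCycle.setoid F) hs⟩
      have hle := Nat.card_le_card_of_surjective _ hsurj
      rw [Nat.card_fin, hX] at hle
      have := Nat.le_of_ble_eq_true hb
      omega
  | cons x xs ih =>
    have hx : x < 24 := hxs x List.mem_cons_self
    have ih' := ih fun y hy => hxs y (List.mem_cons_of_mem _ hy)
    rw [checkFaces_cons] at hcheck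
    cases hb : Nat.beq (Nat.land (Nat.shiftRight mask x) 1) 1 <;> rw [hb] at hcheck
    · rw [cond_false] at hcheck
      rcases h.walk_eq hx false (fun len m => bif Nat.ble l len then
        checkFaces t f l xs (cnt + 1) m (Nat.add key (Nat.shiftLeft 1 (Nat.mul 5 len)))
        else true) 24 x 0 mask hx (by simp) with hw | ⟨len, m, hw, hlen, hp, -, hm⟩
      · rw [hw] at hcheck
        exact absurd hcheck (by simp)
      · rw [hw] at hcheck
        have hle : l ≤ len := (hmin (φ x)).trans
          (((isPeriodicPt_iff_pow F len _).2 hp).minimalPeriod_le hlen)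
        simp only [Nat.ble_eq_true_of_le hle, cond_true] at hcheck
        refine ih' (cnt + 1) m _ (φ x :: X) (by simp [hX]) (fun d hd => ?_) hcheck
        rcases hm d hd with h' | h'
        · obtain ⟨y, hy, hs⟩ := hmask d h'
          exact ⟨y, List.mem_cons_of_mem _ hy, hs⟩
        · exact ⟨φ x, List.mem_cons_self, h'⟩
    · exact ih' cnt mask key X hX hmask hcheck

namespace PartialMap

variable {H : Hypermap} {φ : ℕ → H.Edge} {k : ℕ} {un : List ℕ} {f : ℕ}

theorem frame (h : PartialMap H φ 8 [] f) (hcard : Nat.card H.Edge = 24) :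
    Frame (H.σ * H.α) φ f where
  look_lt a ha := (h.map_look ha (by simp)).1
  map_look a ha := (h.map_look ha (by simp)).2
  inj := h.inj
  surj e := by
    have hinj : Injective fun a : Fin 24 => φ a := fun a b hab =>
      Fin.ext (h.inj a a.2 b b.2 hab)
    obtain ⟨a, rfl⟩ := ((Nat.bijective_iff_injective_and_card _).2
      ⟨hinj, by rw [hcard, Nat.card_fin]⟩).2 e
    exact ⟨a, a.2, rfl⟩

/-- The test verifies the intertwining relations at every edge, so it does not matter how the
candidate map was found, and `f` need not satisfy `IsCode`. -/
theorem isomorphic_of_isoTest (h : PartialMap H φ 8 [] f) (hcard : Nat.card H.Edge = 24)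
    {c r : ℕ} (hc : IsCode c) (hiso : isoTest c f r = true) :
    (codeHypermap hc).Isomorphic H := by
  obtain ⟨h1, h2, h3, -⟩ := isoTest_iff.1 hiso
  have : Nonempty (codeHypermap hc).Edge := ⟨(0 : Fin 24)⟩
  let θ : Fin 24 → H.Edge := fun x => φ (look (isoCode c f r) x)
  have hσ : ∀ e, θ (rotPerm e) = H.σ (θ e) := fun e => by
    change φ (look (isoCode c f r) (rot e)) = _
    rw [h2 e e.2, h.map_rot _ (h3 e e.2)]
  have hf : ∀ e, θ (((codeHypermap hc).σ * (codeHypermap hc).α) e) = (H.σ * H.α) (θ e) :=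
    fun (e : Fin 24) => (congrArg θ (codeHypermap_face hc e)).trans (by
      change φ (look (isoCode c f r) (look c e)) = _
      rw [h1 e e.2, (h.map_look (h3 e e.2) (by simp)).2])
  obtain ⟨ψ, -, hψ⟩ := Hypermap.exists_equiv_of_intertwines (H := codeHypermap hc) (K := H) θ
    (by rw [hcard]; exact Nat.card_fin 24) hσ hf
  exact ⟨ψ, hψ⟩

theorem checkLeaf_sound (h : PartialMap H φ 8 [] f) (hcard : Nat.card H.Edge = 24)
    (hmin : ∀ e, minimalPeriod (H.σ * H.α) (φ 0) ≤ minimalPeriod (H.σ * H.α) e)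
    (hcyc : 6 ≤ Nat.card (Quotient (SameCycle.setoid (H.σ * H.α))))
    {t : List (ℕ × List ℕ)} (hcheck : checkLeaf t 8 f = true) :
    ∃ q ∈ t, ∃ c ∈ q.2, ∀ hc : IsCode c, (codeHypermap hc).Isomorphic H := by
  have hf := h.frame hcard
  change walk f 0 false (fun l _ => checkFaces t f l edges 0 0 0) 24 0 0 0 = true at hcheck
  rcases hf.walk_eq (x := 0) (by omega) false (fun l _ => checkFaces t f l edges 0 0 0) 24 0 0 0
    (by omega) (by simp) with hw | ⟨l, m, hw, hl, hp, hmin', -⟩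
  · rw [hw] at hcheck
    exact absurd hcheck (by simp)
  · rw [hw] at hcheck
    have hl' := Frame.minimalPeriod_eq hl hp hmin'
    obtain ⟨q, hq, c, hc, r, hr⟩ := checkFaces_sound hf (l := l) (by rwa [← hl']) hcyc edges
      (fun x hx => mem_edges.1 hx) 0 0 0 [] rfl (by simp) hcheck
    exact ⟨q, hq, c, hc, fun hc' => h.isomorphic_of_isoTest hcard hc' hr⟩

end PartialMap

theorem forallPicks_cons (g : ℕ → List ℕ → Bool) (e : ℕ) (post pre : List ℕ) :
    forallPicks g (e :: post) pre = true ↔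
      g e (post ++ pre) = true ∧ forallPicks g post (pre ++ [e]) = true := by
  change (Bool.rec false (forallPicks g post (pre ++ [e])) (g e (post ++ pre)) : Bool) = true ↔ _
  cases g e (post ++ pre) <;> simp

theorem forallPicks_sound {g : ℕ → List ℕ → Bool} {l pre : List ℕ}
    (h : forallPicks g l pre = true) {e : ℕ} (he : e ∈ l) (hnd : (pre ++ l).Nodup) :
    ∃ un', g e un' = true ∧ un'.Nodup ∧ ∀ a, a ∈ un' ↔ a ∈ pre ++ l ∧ a ≠ e := by
  induction l generalizing pre with
  | nil => simp at he
  | cons x post ih =>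
    rw [forallPicks_cons] at h
    have hnd' : (pre ++ [x] ++ post).Nodup := by simpa using hnd
    rcases List.mem_cons.1 he with rfl | he
    · have hnd2 : (e :: (post ++ pre)).Nodup :=
        (List.perm_append_comm.trans (by simp)).nodup_iff.1 hnd
      rw [List.nodup_cons] at hnd2
      refine ⟨post ++ pre, h.1, hnd2.2, fun a => ?_⟩
      constructor
      · intro ha
        refine ⟨?_, fun h' => hnd2.1 (h' ▸ ha)⟩
        simp only [List.mem_append, List.mem_cons] at ha ⊢
        tauto
      · rintro ⟨ha, hne⟩
        simp only [List.mem_append, List.mem_cons] at ha ⊢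
        tauto
    · obtain ⟨un', h1, h2, h3⟩ := ih h.2 he hnd'
      exact ⟨un', h1, h2, fun a => by rw [h3]; simp⟩

theorem force_eq {β : Type} (n : ℕ) (K : ℕ → β) : force n K = K n := by
  cases n <;> rfl

theorem search_succ_nil (t : List (ℕ × List ℕ)) (n k f : ℕ) (h : longRootFace f = false) :
    search t (n + 1) k [] f = checkLeaf t k f := by
  change (Bool.rec (checkLeaf t k f) true (longRootFace f) : Bool) = _
  rw [h]

theorem search_succ_cons (t : List (ℕ × List ℕ)) (n k d f : ℕ) (rest : List ℕ)
    (h : longRootFace f = false) :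
    search t (n + 1) k (d :: rest) f = true ↔
      forallPicks (fun e un' => search t n k un' (put (put f d (rot e)) e (rot d))) rest [] = true ∧
      (k ≠ 8 → search t n (k + 1) ((3 * k + 1) :: (3 * k + 2) :: rest)
        (put (put f d (3 * k + 1)) (3 * k) (rot d)) = true) := by
  change (Bool.rec (Bool.rec false (Bool.rec (force _ fun f' => search t n (k + 1) _ f') true
    (Nat.beq k 8)) (forallPicks (fun e un' => force (put (put f d (rot e)) e (rot d)) fun f' =>
      search t n k un' f') rest [])) true (longRootFace f) : Bool) = true ↔ _
  rw [h]
  simp only [force_eq]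
  cases forallPicks (fun e un' => search t n k un' (put (put f d (rot e)) e (rot d))) rest []
  · simp
  · by_cases hk : k = 8
    · subst hk
      simp
    · have hb : Nat.beq k 8 = false := by
        cases hb : Nat.beq k 8
        · rfl
        · exact absurd (Nat.eq_of_beq_eq_true hb) hk
      rw [hb]
      simp only [true_and, ne_eq, hk, not_false_eq_true, forall_const]
      exact Iff.rfl

/-- `H` itself selects a branch at every node: the true partner of the first open edge says whether
to match or to add a vertex. The invariant `PartialMap` is carried along that branch down to a leaf.
-/
theorem search_sound {H : Hypermap} (hσ : ∀ e, H.σ (H.σ (H.σ e)) = e) (hσ' : ∀ e, H.σ e ≠ e)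
    (hinv : ∀ e, H.α (H.α e) = e) (hα : ∀ e, H.α e ≠ e) (hcard : Nat.card H.Edge = 24)
    (hcyc : 6 ≤ Nat.card (Quotient (SameCycle.setoid (H.σ * H.α)))) {t : List (ℕ × List ℕ)}
    (n k : ℕ) (un : List ℕ) (f : ℕ) (φ : ℕ → H.Edge) (h : PartialMap H φ k un f)
    (hroot : minimalPeriod (H.σ * H.α) (φ 0) ≤ 4)
    (hmin : ∀ e, minimalPeriod (H.σ * H.α) (φ 0) ≤ minimalPeriod (H.σ * H.α) e)
    (hs : search t n k un f = true) :
    ∃ q ∈ t, ∃ c ∈ q.2, ∀ hc : IsCode c, (codeHypermap hc).Isomorphic H := by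
  induction n generalizing k un f φ with
  | zero => exact absurd hs (by simp [search])
  | succ n ih =>
    have hlong := h.longRootFace_eq_false hroot
    cases un with
    | nil =>
      rw [search_succ_nil t n k f hlong] at hs
      obtain rfl := h.eq_eight hcard
      exact h.checkLeaf_sound hcard hmin hcyc hs
    | cons d rest =>
      rw [search_succ_cons t n k d f rest hlong] at hs
      have hd3 := h.un_lt d List.mem_cons_self
      by_cases hex : ∃ b < 3 * k, φ b = H.α (φ d)
      · obtain ⟨b, hb, hbd⟩ := hex
        have hne : d ≠ b := by
          rintro rfl
          exact hα _ hbd.symm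
        -- If the partner of `b` were already recorded, it would be `d`, which is still open.
        have hbun : b ∈ d :: rest := by
          by_contra hbun
          obtain ⟨b', hb', hbu', -, hφ'⟩ := h.known b hb hbun
          rw [hbd, hinv] at hφ'
          have := h.inj _ hb' _ hd3 hφ'
          subst this
          exact hbu' List.mem_cons_self
        have hbr : b ∈ rest := (List.mem_cons.1 hbun).resolve_left hne.symm
        have hnd := List.nodup_cons.1 h.nodup
        obtain ⟨un', hs', hnd', hun'⟩ := forallPicks_sound hs.1 hbr (by simpa using hnd.2)
        refine ih k un' _ φ (h.match_step hinv List.mem_cons_self hbun hne hbd (fun a => ?_) hnd')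
          hroot hmin hs'
        rw [hun']
        simp only [List.nil_append, List.mem_cons]
        constructor
        · rintro ⟨ha, hab⟩
          exact ⟨Or.inr ha, fun h' => hnd.1 (h' ▸ ha), hab⟩
        · rintro ⟨ha, had, hab⟩
          exact ⟨ha.resolve_left had, hab⟩
      · push Not at hex
        obtain ⟨hk8, φ', h0, h'⟩ := h.vertex_step hσ hσ' hinv hcard rfl hex
        refine ih (k + 1) _ _ φ' h' ?_ ?_ (hs.2 hk8.ne)
        · rwa [h0]
        · rwa [h0]

/-- Every hypermap of genus `0` with `24` edges, trivalent white vertices and bivalent black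
vertices is isomorphic to one in a table that passes the search. -/
theorem exists_isomorphic_of_search {t : List (ℕ × List ℕ)}
    (ht : search t 13 1 [0, 1, 2] 0 = true) {H : Hypermap}
    (hσ : ∀ e, H.σ (H.σ (H.σ e)) = e) (hσ' : ∀ e, H.σ e ≠ e) (hinv : ∀ e, H.α (H.α e) = e)
    (hα : ∀ e, H.α e ≠ e) (hcard : Nat.card H.Edge = 24)
    (hfaces : Multiset.card (cycleLengths (H.σ * H.α)) = 6) :
    ∃ q ∈ t, ∃ c ∈ q.2, ∀ hc : IsCode c, (codeHypermap hc).Isomorphic H := by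
  have hne : Nonempty H.Edge := (Nat.card_ne_zero.1 (by rw [hcard]; norm_num)).1
  obtain ⟨e, he⟩ := Finite.exists_min fun e => minimalPeriod (H.σ * H.α) e
  -- Six faces of degree at least the minimum have total degree 24.
  have h4 : minimalPeriod (H.σ * H.α) e ≤ 4 := by
    have hsum := sum_cycleLengths (H.σ * H.α)
    have := Multiset.card_nsmul_le_sum (s := cycleLengths (H.σ * H.α))
      (a := minimalPeriod (H.σ * H.α) e) (fun x hx => by
        obtain ⟨e', rfl⟩ := (mem_cycleLengths_iff _).1 hx
        exact he e')
    rw [hsum, hcard, hfaces, smul_eq_mul] at this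
    omega
  let φ : ℕ → H.Edge := fun a => if a = 0 then e else if a = 1 then H.σ e else H.σ (H.σ e)
  have n01 : e ≠ H.σ e := (hσ' e).symm
  have n12 : H.σ e ≠ H.σ (H.σ e) := (hσ' _).symm
  have n02 : e ≠ H.σ (H.σ e) := fun h' => hσ' (H.σ (H.σ e)) (by rw [hσ, ← h'])
  have hrot : rot 0 = 1 ∧ rot 1 = 2 ∧ rot 2 = 0 := by decide +kernel
  have hp : PartialMap H φ 1 [0, 1, 2] 0 := by
    refine ⟨le_rfl, by omega, ?_, ?_, ?_, by decide, ?_, fun a _ => look_zero_left a⟩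
    · intro a ha b hb hab
      simp only [φ] at hab
      interval_cases a <;> interval_cases b <;> simp_all
    · intro a ha
      interval_cases a
      · rw [hrot.1]; rfl
      · rw [hrot.2.1]; rfl
      · rw [hrot.2.2]; exact (hσ e).symm
    · decide
    · intro a ha hau
      exfalso
      simp only [List.mem_cons, List.not_mem_nil, or_false] at hau
      omega
  exact search_sound hσ hσ' hinv hα hcard (by rw [← card_cycleLengths, hfaces]) 13 1 _ _ φ hp h4
    he ht

end Dessins

/-! ### Symmetries of codes -/

namespace Dessins

open Function

/-! ### Isomorphisms and symmetries as permutations of 24 edges -/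

section CodeIsomorphisms

variable {c d : ℕ} (hc : IsCode c) (hd : IsCode d)

/-- This is the completeness of `isoTest`: every actual morphism is the one that the test
reconstructs from the image of 0, so a failed test at all `r` excludes an isomorphism. -/
theorem codeHypermap_isomorphism_apply {ψ : Fin 24 → Fin 24}
    (hσ : ∀ e, ψ (rotPerm e) = rotPerm (ψ e))
    (hα : ∀ e, ψ (partnerPerm hc e) = partnerPerm hd (ψ e)) :
    (∀ x : Fin 24, look (isoCode c d (ψ 0)) x = ψ x) ∧ isoTest c d (ψ 0) = true := by
  let ψ' : ℕ → ℕ := fun x => if h : x < 24 then (ψ ⟨x, h⟩ : ℕ) else 0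
  have hψ' : ∀ x (h : x < 24), ψ' x = ψ ⟨x, h⟩ := fun x h => dif_pos h
  have hlt : ∀ x < 24, ψ' x < 24 := fun x h => by
    rw [hψ' x h]
    exact (ψ _).2
  have hrot : ∀ x < 24, ψ' (rot x) = rot (ψ' x) := fun x h => by
    rw [hψ' _ (rot_lt h), hψ' x h]
    exact congrArg Fin.val (hσ ⟨x, h⟩)
  have hlook : ∀ x < 24, ψ' (look c x) = look d (ψ' x) := fun x h => by
    have h1 : ψ' (partner c x) = partner d (ψ' x) := by
      rw [hψ' _ (hc.partner_lt_card h), hψ' x h]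
      exact congrArg Fin.val (hα ⟨x, h⟩)
    rw [← hc.rot_partner h, ← hd.rot_partner (hlt x h), hrot _ (hc.partner_lt_card h), h1]
  have key := look_isoCode hc ψ' hlt hrot hlook
  rw [show ψ' 0 = ψ 0 from hψ' 0 (by omega)] at key
  refine ⟨fun x => (key x x.2).trans (hψ' x x.2), isoTest_iff.2 ⟨fun x h => ?_, fun x h => ?_,
    fun x h => ?_, key 0 (by omega) |>.trans (hψ' 0 (by omega))⟩⟩
  · rw [key _ (hc.look_lt x h), key x h, hlook x h]
  · rw [key _ (rot_lt h), key x h, hrot x h]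
  · rw [key x h]
    exact hlt x h

theorem exists_isoTest_of_isomorphic
    (h : (codeHypermap hc).Isomorphic (codeHypermap hd)) : ∃ r < 24, isoTest c d r = true := by
  obtain ⟨ψ, hσ, hα⟩ := h
  change Fin 24 ≃ Fin 24 at ψ
  exact ⟨ψ 0, (ψ 0).2, (codeHypermap_isomorphism_apply hc hd hσ hα).2⟩

/-- The symmetries as permutations of the edges `0, …, 23`. -/
def codeSymmetries : Subgroup (Equiv.Perm (Fin 24)) := (codeHypermap hc).symmetryGroup

theorem mem_codeSymmetries_iff {g : Equiv.Perm (Fin 24)} :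
    g ∈ codeSymmetries hc ↔ (∀ e, g (rotPerm e) = rotPerm (g e)) ∧
      ∀ e, g (partnerPerm hc e) = partnerPerm hc (g e) := by
  change g ∈ Subgroup.centralizer {rotPerm, partnerPerm hc} ↔ _
  simp only [Subgroup.mem_centralizer_iff, Set.mem_insert_iff, Set.mem_singleton_iff,
    forall_eq_or_imp, forall_eq]
  simp only [Equiv.ext_iff, Equiv.Perm.mul_apply]
  exact and_congr (forall_congr' fun _ => eq_comm) (forall_congr' fun _ => eq_comm)

theorem symmetry_apply {g : Equiv.Perm (Fin 24)} (hg : g ∈ codeSymmetries hc)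
    (x : Fin 24) : look (isoCode c c (g 0)) x = g x :=
  (codeHypermap_isomorphism_apply hc hc ((mem_codeSymmetries_iff hc).1 hg).1
    ((mem_codeSymmetries_iff hc).1 hg).2).1 x

theorem isoTest_symmetry {g : Equiv.Perm (Fin 24)}
    (hg : g ∈ codeSymmetries hc) : isoTest c c (g 0) = true :=
  (codeHypermap_isomorphism_apply hc hc ((mem_codeSymmetries_iff hc).1 hg).1
    ((mem_codeSymmetries_iff hc).1 hg).2).2

/-- The symmetry group acts freely on the edges. This makes it correspond to the set of admissible
images of 0. -/
theorem symmetry_ext {g h : Equiv.Perm (Fin 24)} (hg : g ∈ codeSymmetries hc)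
    (hh : h ∈ codeSymmetries hc) (h0 : g 0 = h 0) : g = h := by
  ext x
  rw [← symmetry_apply hc hg, ← symmetry_apply hc hh, h0]

theorem exists_symmetry {r : Fin 24} (hr : isoTest c c r = true) :
    ∃ g ∈ codeSymmetries hc, g 0 = r := by
  obtain ⟨h1, h2, h3, h4⟩ := isoTest_iff.1 hr
  have : Nonempty (codeHypermap hc).Edge := ⟨(0 : Fin 24)⟩
  let θ : Fin 24 → Fin 24 := fun x => ⟨look (isoCode c c r) x, h3 x x.2⟩
  obtain ⟨ψ, hθ, hψ⟩ := Hypermap.exists_equiv_of_intertwines (H := codeHypermap hc)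
    (K := codeHypermap hc) θ rfl (fun (e : Fin 24) => Fin.ext (h2 e e.2))
    (fun (e : Fin 24) => (congrArg θ (codeHypermap_face hc e)).trans
      ((Fin.ext (h1 e e.2)).trans (codeHypermap_face hc (θ e)).symm))
  change Fin 24 ≃ Fin 24 at ψ
  have hθ' : ∀ e : Fin 24, ψ e = θ e := hθ
  exact ⟨ψ, (mem_codeSymmetries_iff hc).2 hψ, (hθ' 0).trans (Fin.ext h4)⟩

end CodeIsomorphisms

theorem card_subtype_fin (p : ℕ → Bool) :
    Nat.card {x : Fin 24 // p x = true} = (edges.filter p).length := by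
  rw [Nat.card_eq_fintype_card, Fintype.card_subtype,
    show edges = (List.finRange 24).map Fin.val by decide, List.filter_map, List.length_map]
  change Multiset.card (Multiset.filter _ (List.finRange 24 : Multiset (Fin 24))) = _
  rw [Multiset.filter_coe, Multiset.coe_card]
  congr 2
  funext x
  simp

/-! ### Order and exponent of the symmetry group -/

section Symmetry

variable {c : ℕ} (hc : IsCode c)

/-- The number of symmetries of a code. -/
def numSymmetries (c : ℕ) : ℕ := (edges.filter fun r => isoTest c c r).length

/-- All symmetries of a code have order at most two. -/
def allSquaresTrivial (c : ℕ) : Bool :=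
  edges.all fun r => or (not (isoTest c c r)) (Nat.beq (look (isoCode c c r) r) 0)

theorem card_codeSymmetries : Nat.card (codeSymmetries hc) = numSymmetries c := by
  rw [numSymmetries, ← card_subtype_fin]
  refine Nat.card_congr (Equiv.ofBijective
    (fun g => ⟨g.1 0, isoTest_symmetry hc g.2⟩) ⟨fun g h hgh => ?_, ?_⟩)
  · exact Subtype.ext (symmetry_ext hc g.2 h.2 (congrArg Subtype.val hgh))
  · rintro ⟨r, hr⟩
    obtain ⟨g, hg, rfl⟩ := exists_symmetry hc hr
    exact ⟨⟨g, hg⟩, rfl⟩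

theorem allSquaresTrivial_iff : allSquaresTrivial c = true ↔
    ∀ g : codeSymmetries hc, g * g = 1 := by
  -- By freeness, `g * g = 1` already follows from g(g(0)) = 0.
  have key : ∀ g : codeSymmetries hc,
      g * g = 1 ↔ look (isoCode c c (g.1 0))
        (g.1 0) = 0 := by
    intro g
    rw [symmetry_apply hc g.2, ← Fin.val_zero 24, ← Fin.ext_iff]
    constructor
    · intro h
      exact Equiv.congr_fun (congrArg Subtype.val h) 0
    · intro h
      exact Subtype.ext (symmetry_ext hc (mul_mem g.2 g.2) (one_mem _) h)
  simp only [key, allSquaresTrivial, List.all_eq_true, mem_edges, Bool.or_eq_true,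
    Bool.not_eq_true', Nat.beq_eq]
  constructor
  · intro h g
    have := h _ (g.1 0).2
    rw [isoTest_symmetry hc g.2] at this
    simpa using this
  · intro h r hr
    by_cases ht : isoTest c c r = true
    · obtain ⟨g, hg, h0⟩ := exists_symmetry hc (r := ⟨r, hr⟩) ht
      have := h ⟨g, hg⟩
      rw [h0] at this
      exact Or.inr this
    · exact Or.inl (by simpa using ht)

end Symmetry

/-! ### Recognizing groups of order at most four -/

section SmallGroups

variable {G : Type*} [Group G]

theorem nonempty_mulEquiv_unit_iff : Nonempty (G ≃* Unit) ↔ Nat.card G = 1 := by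
  constructor
  · rintro ⟨e⟩
    rw [Nat.card_congr e.toEquiv]
    simp
  · intro h
    rw [Nat.card_eq_one_iff_unique] at h
    obtain ⟨_, _⟩ := h
    let _ : Unique G := ⟨⟨1⟩, fun _ => Subsingleton.elim _ _⟩
    exact ⟨MulEquiv.ofUnique⟩

theorem nonempty_mulEquiv_C_iff_of_prime (p : ℕ) [hp : Fact p.Prime] :
    Nonempty (G ≃* C p) ↔ Nat.card G = p := by
  constructor
  · rintro ⟨e⟩
    rw [Nat.card_congr e.toEquiv]
    simp
  · intro h
    exact ⟨mulEquivOfPrimeCardEq (p := p) h (by simp)⟩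

theorem nonempty_mulEquiv_V4_iff :
    Nonempty (G ≃* V4) ↔ Nat.card G = 4 ∧ ∀ g : G, g * g = 1 := by
  constructor
  · rintro ⟨e⟩
    refine ⟨by rw [Nat.card_congr e.toEquiv]; simp [Nat.card_eq_fintype_card], fun g => ?_⟩
    apply e.injective
    rw [map_mul, map_one]
    generalize e g = x
    revert x
    decide
  · rintro ⟨h4, hsq⟩
    have : Finite G := Nat.finite_of_card_ne_zero (by omega)
    have key : ∀ {K : Type _} [Group K], Nat.card K = 4 → (∀ g : K, g * g = 1) → IsKleinFour K := by
      intro K _ h4 hsq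
      refine ⟨h4, ?_⟩
      have h1 : Monoid.exponent K ∣ 2 := Monoid.exponent_dvd_of_forall_pow_eq_one
        fun g => by rw [pow_two, hsq]
      rcases (Nat.dvd_prime Nat.prime_two).1 h1 with h | h
      · rw [Monoid.exp_eq_one_iff, ← Nat.card_eq_one_iff_unique.trans (and_iff_left ⟨1⟩)] at h
        omega
      · exact h
    have h1 : IsKleinFour G := key h4 hsq
    have h2 : IsKleinFour V4 := ⟨by simp [Nat.card_eq_fintype_card], by
      have h1 : Monoid.exponent V4 ∣ 2 := Monoid.exponent_dvd_of_forall_pow_eq_one (by decide)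
      rcases (Nat.dvd_prime Nat.prime_two).1 h1 with h | h
      · rw [Monoid.exp_eq_one_iff] at h
        exact absurd (Subsingleton.elim (Multiplicative.ofAdd ((1, 0) : ZMod 2 × ZMod 2)) 1)
          (by decide)
      · exact h⟩
    exact IsKleinFour.nonempty_mulEquiv

theorem nonempty_mulEquiv_C4_iff :
    Nonempty (G ≃* C 4) ↔ Nat.card G = 4 ∧ ¬ ∀ g : G, g * g = 1 := by
  constructor
  · rintro ⟨e⟩
    refine ⟨by rw [Nat.card_congr e.toEquiv]; simp, fun h => ?_⟩
    have h1 := h (e.symm (Multiplicative.ofAdd 1))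
    rw [← map_mul, MulEquiv.map_eq_one_iff] at h1
    exact absurd h1 (by decide)
  · rintro ⟨h4, hsq⟩
    have : Finite G := Nat.finite_of_card_ne_zero (by omega)
    push Not at hsq
    obtain ⟨g, hg⟩ := hsq
    have hord : orderOf g = 4 := by
      have h1 : orderOf g ∣ 4 := h4 ▸ orderOf_dvd_natCard g
      have h2 : ¬ orderOf g ∣ 2 := fun h => hg (by
        rw [← pow_two]
        exact orderOf_dvd_iff_pow_eq_one.1 h)
      have h3 : orderOf g ≤ 4 := Nat.le_of_dvd (by norm_num) h1
      interval_cases orderOf g <;> omega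
    have : IsCyclic G := isCyclic_of_orderOf_eq_card g (by rw [hord, h4])
    exact ⟨mulEquivOfCyclicCardEq (by rw [h4]; simp)⟩

end SmallGroups

end Dessins

/-! ### Dessins and codes -/

namespace Dessins

open Function

/-! ### Loops and faces of degree one -/

section Loops

/-- In a hypermap with trivalent white and bivalent black vertices the loops correspond to the
faces of degree one. -/
theorem numLoops_eq_count {H : Hypermap} (hσ : ∀ e, H.σ (H.σ (H.σ e)) = e)
    (hσ' : ∀ e, H.σ e ≠ e) (hinv : ∀ e, H.α (H.α e) = e) (hα : ∀ e, H.α e ≠ e) :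
    H.numLoops = H.faceDegrees.count 1 := by
  have hcount := count_cycleLengths_mul (H.σ * H.α) 1
  rw [mul_one] at hcount
  rw [Hypermap.faceDegrees, hcount, Hypermap.numLoops, ← Nat.card_coe_set_eq]
  have hfix : ∀ e, minimalPeriod (H.σ * H.α) e = 1 ↔ H.σ (H.α e) = e := fun e =>
    minimalPeriod_eq_one_iff_isFixedPt
  have hσ3 : H.σ ^ 3 = 1 := by
    ext e
    rw [pow_succ, pow_two]
    exact hσ e
  have hα2 : H.α ^ 2 = 1 := by
    ext e
    rw [pow_two]
    exact hinv e
  have hσcases : ∀ x y, H.σ.SameCycle x y → y = x ∨ y = H.σ x ∨ y = H.σ (H.σ x) := by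
    rintro x _ ⟨i, rfl⟩
    have h1 : H.σ ^ i = H.σ ^ (i % 3) := by exact_mod_cast zpow_eq_zpow_emod' i hσ3
    have h2 : i % 3 = 0 ∨ i % 3 = 1 ∨ i % 3 = 2 := by omega
    rw [h1]
    rcases h2 with h2 | h2 | h2 <;> rw [h2]
    · exact Or.inl rfl
    · exact Or.inr (Or.inl rfl)
    · exact Or.inr (Or.inr rfl)
  have hαcases : ∀ x y, H.α.SameCycle x y → y = x ∨ y = H.α x := by
    rintro x _ ⟨i, rfl⟩
    have h1 : H.α ^ i = H.α ^ (i % 2) := by exact_mod_cast zpow_eq_zpow_emod' i hα2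
    have h2 : i % 2 = 0 ∨ i % 2 = 1 := by omega
    rw [h1]
    rcases h2 with h2 | h2 <;> rw [h2]
    · exact Or.inl rfl
    · exact Or.inr rfl
  have hmem : ∀ e, H.σ (H.α e) = e → Quotient.mk _ e ∈ H.loops := fun e he =>
    ⟨e, rfl, hα e, hinv e, by
      have : H.σ.SameCycle (H.α e) (H.σ (H.α e)) := ⟨1, by simp⟩
      rw [he] at this
      exact this.symm⟩
  symm
  refine Nat.card_congr (Equiv.ofBijective
    (fun e => ⟨Quotient.mk _ e.1, hmem e.1 ((hfix _).1 e.2)⟩) ⟨?_, ?_⟩)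
  -- Two partners cannot both lie on faces of degree one: σ would exchange them, and σ³ = 1 would
  -- then give a fixed point.
  · rintro ⟨x, hx⟩ ⟨y, hy⟩ hxy
    rw [hfix] at hx hy
    have h1 : H.α.SameCycle x y :=
      Quotient.exact (s := Equiv.Perm.SameCycle.setoid H.α) (congrArg Subtype.val hxy)
    rcases hαcases x y h1 with h | h
    · exact Subtype.ext h.symm
    · exfalso
      subst h
      rw [hinv] at hy
      have h2 := hσ x
      rw [hy, hx] at h2
      exact hσ' _ h2
  -- At a trivalent vertex αe is σe or σ²e. In the first case σα fixes αe, in the second it fixes e.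
  · rintro ⟨_, e, rfl, -, -, hs⟩
    rcases hσcases _ _ hs with h | h | h
    · exact absurd h (hα e)
    · refine ⟨⟨H.α e, (hfix _).2 (by rw [hinv, h])⟩, Subtype.ext ?_⟩
      exact Quotient.sound (s := Equiv.Perm.SameCycle.setoid H.α)
        (Equiv.Perm.SameCycle.symm ⟨1, by simp⟩)
    · exact ⟨⟨e, (hfix _).2 (by rw [h, hσ])⟩, rfl⟩

end Loops

/-! ### Euler characteristic -/

section Genus

theorem card_white {H : Hypermap} (hσ : ∀ e, H.σ (H.σ (H.σ e)) = e)
    (hσ' : ∀ e, H.σ e ≠ e) : Multiset.card (cycleLengths H.σ) * 3 = Nat.card H.Edge :=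
  card_cycleLengths_mul _ fun e => minimalPeriod_eq_prime (hσ e) (hσ' e)

theorem card_black {H : Hypermap} (hinv : ∀ e, H.α (H.α e) = e) (hα : ∀ e, H.α e ≠ e) :
    Multiset.card (cycleLengths H.α) * 2 = Nat.card H.Edge :=
  card_cycleLengths_mul _ fun e => minimalPeriod_eq_prime (hinv e) (hα e)

theorem isGenusZero_iff {H : Hypermap} (hσ : ∀ e, H.σ (H.σ (H.σ e)) = e) (hσ' : ∀ e, H.σ e ≠ e)
    (hinv : ∀ e, H.α (H.α e) = e) (hα : ∀ e, H.α e ≠ e) (hcard : Nat.card H.Edge = 24) :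
    H.IsGenusZero ↔ Multiset.card H.faceDegrees = 6 := by
  have h1 := card_white hσ hσ'
  have h2 := card_black hinv hα
  rw [Hypermap.IsGenusZero, Hypermap.faceDegrees]
  omega

theorem Hypermap.Isomorphic.isGenusZero {H K : Hypermap} (h : H.Isomorphic K)
    (hK : K.IsGenusZero) : H.IsGenusZero := by
  have hf := h.faceDegrees_eq
  obtain ⟨ψ, hσ, hα⟩ := h
  rw [Hypermap.faceDegrees, Hypermap.faceDegrees] at hf
  rw [Hypermap.IsGenusZero, hf, cycleLengths_congr ψ _ _ hσ, cycleLengths_congr ψ _ _ hα,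
    Nat.card_congr ψ]
  exact hK

end Genus

/-! ### From subgroups to codes and back -/

section Subgroups

/-- If `a` fixes the coset gΓ, then g⁻¹ag is an element of finite order in Γ. -/
theorem smul_ne_of_isOfFinOrder {Γ : Subgroup PSL2Z}
    (hΓ : ∀ g ∈ Γ, IsOfFinOrder g → g = 1) {a : PSL2Z}
    (ha : IsOfFinOrder a) (ha1 : a ≠ 1) (x : PSL2Z ⧸ Γ) : a • x ≠ x := by
  induction x using QuotientGroup.induction_on with | H g => ?_
  intro h
  change ((a * g : PSL2Z) : PSL2Z ⧸ Γ) = g at h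
  rw [eq_comm, QuotientGroup.eq] at h
  have h1 : IsConj a (g⁻¹ * (a * g)) := isConj_iff.2 ⟨g⁻¹, by group⟩
  have h2 := hΓ _ h ((isConj_iff.1 h1).elim fun c hc => hc ▸ (by
    have := (MulAut.conj c).toMonoidHom.isOfFinOrder ha
    simpa using this))
  rw [h2, isConj_one_left] at h1
  exact ha1 h1

theorem isOfFinOrder_S : IsOfFinOrder S :=
  isOfFinOrder_iff_pow_eq_one.2 ⟨2, two_pos, by rw [pow_two, S_mul_S]⟩

theorem isOfFinOrder_ST : IsOfFinOrder (S * T) :=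
  isOfFinOrder_iff_pow_eq_one.2 ⟨3, three_pos, by rw [pow_succ', pow_two, ST_cube]⟩

theorem dessin_σ_cube (Γ : Subgroup PSL2Z) [Γ.FiniteIndex] (e : (dessin Γ).Edge) :
    (dessin Γ).σ ((dessin Γ).σ ((dessin Γ).σ e)) = e := by
  change PSL2Z ⧸ Γ at e
  change (S * T) • (S * T) • (S * T) • e = e
  rw [smul_smul, smul_smul, mul_assoc, ST_cube, one_smul]

theorem dessin_α_square (Γ : Subgroup PSL2Z) [Γ.FiniteIndex] (e : (dessin Γ).Edge) :
    (dessin Γ).α ((dessin Γ).α e) = e := by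
  change PSL2Z ⧸ Γ at e
  change S • S • e = e
  rw [smul_smul, S_mul_S, one_smul]

variable {c : ℕ} (hc : IsCode c)

theorem rotPerm_cube (e : Fin 24) : rotPerm (rotPerm (rotPerm e)) = e :=
  Fin.ext (rot_rot_rot e.2)

theorem rotPerm_ne (e : Fin 24) : rotPerm e ≠ e := fun h =>
  (rot_spec e e.2).2.2.1 (congrArg Fin.val h)

theorem partnerPerm_square (e : Fin 24) : partnerPerm hc (partnerPerm hc e) = e :=
  Fin.ext (hc.partner_partner e e.2)

theorem partnerPerm_ne (e : Fin 24) : partnerPerm hc e ≠ e := fun h =>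
  hc.partner_ne e e.2 (congrArg Fin.val h)

/-- A code of genus zero is isomorphic to the dessin of a torsion-free subgroup. -/
theorem exists_subgroup_of_code (h6 : Multiset.card (codeHypermap hc).faceDegrees = 6) :
    ∃ Γ : TorsionFreeGenusZero 24, (dessin Γ.group).Isomorphic (codeHypermap hc) := by
  obtain ⟨ρ, hS, hST⟩ := exists_hom_of_relations (partnerPerm hc) rotPerm
    (Equiv.ext (partnerPerm_square hc)) (Equiv.ext rotPerm_cube)
  -- The stabilizer of the edge 0; by the orbit map, its cosets are the 24 edges.
  let Γ : Subgroup PSL2Z := (MulAction.stabilizer (Equiv.Perm (Fin 24)) (0 : Fin 24)).comap ρ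
  have hmem : ∀ g, g ∈ Γ ↔ ρ g 0 = 0 := fun g => Iff.rfl
  let θ : PSL2Z ⧸ Γ → Fin 24 := Quotient.lift (fun g => ρ g 0) fun a b hab => by
    have h := (hmem _).1 (QuotientGroup.leftRel_apply.1 hab)
    rw [map_mul, map_inv, Equiv.Perm.mul_apply, Equiv.Perm.inv_eq_iff_eq] at h
    exact h.symm
  have hθ : ∀ g : PSL2Z, θ (g : PSL2Z ⧸ Γ) = ρ g 0 := fun _ => rfl
  have hsmul : ∀ (a : PSL2Z) (x : PSL2Z ⧸ Γ), θ (a • x) = ρ a (θ x) := by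
    intro a x
    induction x using QuotientGroup.induction_on with | H g => ?_
    change ρ (a * g) 0 = ρ a (ρ g 0)
    rw [map_mul, Equiv.Perm.mul_apply]
  have hinj : Injective θ := by
    intro x y hxy
    induction x using QuotientGroup.induction_on with | H g => ?_
    induction y using QuotientGroup.induction_on with | H h => ?_
    rw [hθ, hθ] at hxy
    rw [QuotientGroup.eq, hmem, map_mul, map_inv, Equiv.Perm.mul_apply, ← hxy]
    exact Equiv.symm_apply_apply _ _
  have hsurj : Surjective θ := by
    intro y
    have := (codeHypermap hc).mem_of_closed (s := Set.range θ) ⟨_, ((1 : PSL2Z) : PSL2Z ⧸ Γ), rfl⟩ ?_ ?_ y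
    · exact this
    · rintro _ ⟨x, rfl⟩
      exact ⟨(S * T) • x, by rw [hsmul, hST]; rfl⟩
    · rintro _ ⟨x, rfl⟩
      exact ⟨S • x, by rw [hsmul, hS]; rfl⟩
  let e : PSL2Z ⧸ Γ ≃ Fin 24 := Equiv.ofBijective θ ⟨hinj, hsurj⟩
  have hindex : Γ.index = 24 := by rw [Subgroup.index, Nat.card_congr e, Nat.card_fin]
  have hfin : Γ.FiniteIndex := ⟨by rw [hindex]; norm_num⟩
  have hiso : (dessin Γ).Isomorphic (codeHypermap hc) :=
    ⟨e, fun x => (hsmul (S * T) x).trans (by rw [hST]; rfl),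
      fun x => (hsmul S x).trans (by rw [hS]; rfl)⟩
  -- Conjugates of stabilizer elements have fixed points. Torsion in Γ would thus give a fixed point
  -- of α, σ or σ², and none exists.
  have hconj : ∀ g a : PSL2Z, g ∈ Γ → IsConj g a → ∃ x, ρ a x = x := by
    intro g a hg ha
    obtain ⟨b, rfl⟩ := isConj_iff.1 ha
    refine ⟨ρ b 0, ?_⟩
    simp [(hmem g).1 hg]
  refine ⟨⟨Γ, hindex, ?_, ?_⟩, hiso⟩
  · intro g hg hfin
    rcases isConj_of_isOfFinOrder hfin with h | h | h | h
    · exact h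
    · obtain ⟨x, hx⟩ := hconj g _ hg h
      rw [hS] at hx
      exact absurd hx (partnerPerm_ne hc x)
    · obtain ⟨x, hx⟩ := hconj g _ hg h
      rw [hST] at hx
      exact absurd hx (rotPerm_ne x)
    · obtain ⟨x, hx⟩ := hconj g _ hg h
      rw [map_mul, hST, Equiv.Perm.mul_apply] at hx
      have := rotPerm_cube x
      rw [hx] at this
      exact absurd this (rotPerm_ne x)
  · exact hiso.isGenusZero ((isGenusZero_iff (H := codeHypermap hc) rotPerm_cube rotPerm_ne
      (partnerPerm_square hc) (partnerPerm_ne hc) (Nat.card_fin 24)).2 h6)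

/-- The dessin of a torsion-free subgroup of index `24` and genus zero is in a table that passes
the search. -/
theorem exists_code_of_subgroup {t : List (ℕ × List ℕ)} (ht : search t 13 1 [0, 1, 2] 0 = true)
    (Γ : TorsionFreeGenusZero 24) :
    ∃ q ∈ t, ∃ c ∈ q.2, ∀ hc : IsCode c, (codeHypermap hc).Isomorphic (dessin Γ.group) := by
  have hσ' : ∀ e, (dessin Γ.group).σ e ≠ e :=
    smul_ne_of_isOfFinOrder Γ.torsionFree isOfFinOrder_ST ST_ne_one
  have hα : ∀ e, (dessin Γ.group).α e ≠ e :=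
    smul_ne_of_isOfFinOrder Γ.torsionFree isOfFinOrder_S S_ne_one
  have hcard : Nat.card (dessin Γ.group).Edge = 24 := Γ.index_eq
  exact exists_isomorphic_of_search ht (dessin_σ_cube _) hσ' (dessin_α_square _) hα hcard
    ((isGenusZero_iff (dessin_σ_cube _) hσ' (dessin_α_square _) hα hcard).1 Γ.genusZero)

end Subgroups

/-! ### Face degrees of a code -/

section FaceDegrees

/-- The period of `x` under the permutation with the code `c`. -/
def period (c x : ℕ) : ℕ := walk c x 0 (fun l _ => l) 24 x 0 0

/-- The list of numbers in which `l` occurs as often as the digit `l` of `k` says. -/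
def digitList (k : ℕ) : List ℕ := (List.range 25).flatMap fun l => List.replicate (look k l) l

/-- Continue with the list of the values of `g`, which are evaluated first. -/
def forceMap {β : Type} (g : ℕ → ℕ) : List ℕ → (List ℕ → β) → β
  | [], K => K []
  | x :: xs, K => force (g x) fun y => forceMap g xs fun ys => K (y :: ys)

theorem forceMap_eq {β : Type} (g : ℕ → ℕ) (xs : List ℕ) (K : List ℕ → β) :
    forceMap g xs K = K (xs.map g) := by
  induction xs generalizing K with
  | nil => rfl
  | cons x xs ih => rw [forceMap, force_eq, ih, List.map_cons]

/-- The number of occurrences of `l` in a list. -/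
def occurrences (l : ℕ) (ps : List ℕ) : ℕ :=
  List.rec 0 (fun p _ ih => Bool.rec ih (Nat.succ ih) (Nat.beq p l)) ps

theorem occurrences_eq (l : ℕ) (ps : List ℕ) :
    occurrences l ps = (ps.filter fun p => Nat.beq p l).length := by
  induction ps with
  | nil => rfl
  | cons p ps ih =>
    change (Bool.rec (occurrences l ps) (occurrences l ps + 1) (Nat.beq p l) : ℕ) = _
    rw [List.filter_cons, ih]
    cases Nat.beq p l <;> rfl

/-- The face degrees of the code `c` are given by `k`. -/
def degreesTest (k c : ℕ) : Bool :=
  forceMap (period c) edges fun ps =>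
    and (Nat.beq (look k 0) 0) (and (ps.all fun p => and (Nat.blt 0 p) (Nat.ble p 24))
      ((List.range 25).all fun l => Nat.beq (Nat.mul (look k l) l) (occurrences l ps)))

theorem count_digitList (k l : ℕ) : (digitList k).count l = if l < 25 then look k l else 0 := by
  have h : ∀ n, ((List.range n).flatMap fun l => List.replicate (look k l) l).count l =
      if l < n then look k l else 0 := by
    intro n
    induction n with
    | zero => simp
    | succ n ih =>
      rw [List.range_succ, List.flatMap_append, List.count_append, ih]
      simp only [List.flatMap_singleton, List.count_replicate, beq_iff_eq]
      split_ifs <;> first | omega | (subst_vars; omega)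
  exact h 25

variable {c : ℕ} (hc : IsCode c)

theorem frame_code : Frame (rotPerm * partnerPerm hc)
    (fun a => if h : a < 24 then (⟨a, h⟩ : Fin 24) else 0) c where
  look_lt := hc.look_lt
  map_look a ha := by
    rw [dif_pos (hc.look_lt a ha), dif_pos ha]
    exact (codeHypermap_face hc ⟨a, ha⟩).symm
  inj a ha b hb h := by
    rw [dif_pos ha, dif_pos hb] at h
    exact congrArg Fin.val h
  surj e := ⟨e, e.2, by rw [dif_pos e.2]⟩

/-- The value 0 signals that the walk ran out of fuel, so positivity certifies that it closed up. -/
theorem minimalPeriod_code (x : Fin 24) (hx : 0 < period c x) :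
    minimalPeriod (rotPerm * partnerPerm hc) x = period c x := by
  have h := (frame_code hc).walk_eq (x := x) x.2 0 (fun l _ => l) 24 x 0 0 x.2 rfl
  rcases h with h | ⟨l, m, h, hl, hp, hmin, -⟩
  · exact absurd h hx.ne'
  · rw [period, h]
    rw [dif_pos x.2] at hp hmin
    exact Frame.minimalPeriod_eq hl hp hmin

theorem faceDegrees_code {k : ℕ} (h : degreesTest k c = true) :
    (codeHypermap hc).faceDegrees = (digitList k : Multiset ℕ) := by
  simp only [degreesTest, forceMap_eq, occurrences_eq, List.all_map, List.filter_map, List.length_map,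
    Bool.and_eq_true, List.all_eq_true, mem_edges, List.mem_range, comp_apply, Nat.beq_eq] at h
  obtain ⟨h0, hpos, hcount⟩ := h
  have hper : ∀ x : Fin 24,
      minimalPeriod (rotPerm * partnerPerm hc) x = period c x := fun x =>
    minimalPeriod_code hc x (Nat.blt_eq ▸ (hpos x x.2).1)
  apply cycleLengths_eq_of_count
  · rw [Multiset.mem_coe, ← List.count_pos_iff, count_digitList, if_pos (by omega), h0]
    exact lt_irrefl 0
  · intro l
    rw [Multiset.coe_count, count_digitList]
    have hcard : Nat.card {x : (codeHypermap hc).Edge //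
        minimalPeriod ((codeHypermap hc).σ * (codeHypermap hc).α) x = l} =
        Nat.card {x : Fin 24 // Nat.beq (period c x) l = true} :=
      Nat.card_congr (Equiv.subtypeEquivRight fun (x : Fin 24) => by
        rw [← hper x, Nat.beq_eq]
        rfl)
    refine Eq.trans ?_ (hcard.trans (card_subtype_fin fun x => Nat.beq (period c x) l)).symm
    split_ifs with hl
    · exact hcount l hl
    · rw [zero_mul, eq_comm, List.length_eq_zero_iff, List.filter_eq_nil_iff]
      intro x hx
      have := (hpos x (mem_edges.1 hx)).2
      rw [Nat.ble_eq] at this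
      rw [Nat.beq_eq]
      omega

theorem numLoops_code : (codeHypermap hc).numLoops = (codeHypermap hc).faceDegrees.count 1 :=
  numLoops_eq_count (H := codeHypermap hc) rotPerm_cube rotPerm_ne (partnerPerm_square hc)
    (partnerPerm_ne hc)

end FaceDegrees

end Dessins

/-! ### The computations -/

namespace Dessins

/-- The table as a list of pairs of a code of the face degrees and a code. -/
def pairs : List (ℕ × ℕ) := table.flatMap fun q => q.2.map fun c => (q.1, c)

/-- `1`, `2`, `3`, `4`, `5` for the symmetry groups `1`, `ℤ/2`, `ℤ/3`, `ℤ/4`, `ℤ/2 × ℤ/2`. -/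
def symmetryType (c : ℕ) : ℕ :=
  (fun n => bif Nat.beq n 4 then bif allSquaresTrivial c then 5 else 4
    else bif Nat.ble n 3 then n else 0) (numSymmetries c)

/-- The elements of the list are pairwise not isomorphic. -/
def separated (l : List (ℕ × ℕ)) : Bool :=
  List.rec true (fun x xs ih => and (xs.all fun y =>
    bif Nat.beq x.1 y.1 then edges.all fun r => not (isoTest x.2 y.2 r) else true) ih) l

/-- The face degrees and symmetry types of the codes with loops and nontrivial symmetries. -/
def exceptional : List (ℕ × ℕ) :=
  [(2214592576, 2), (2214592576, 2), (3222274112, 2), (68721573952, 2), (68721573952, 2),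
  (103079215200, 3), (2199023321152, 2), (2199023321152, 2), (2199023321152, 2), (2199024305216,
  2), (70368744179776, 2), (70368744179776, 2), (70368744179776, 2), (70368744179776, 2),
  (1125899973952576, 2), (1125899973952576, 2), (2251799813685376, 2), (2251799813685376, 2),
  (2251799813685376, 5), (1152921504607961152, 2), (1152921505680590912, 2),
  (1208925819614629174709312, 2), (1208925819614629175754880, 4), (1237940039285380274899125376,
  2)]

set_option maxRecDepth 100000

/-- Completeness of the table. Every step installs one of the 12 black vertices and the leaf takes
one more unit of fuel, hence 13. Running out of fuel would give `false`. -/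
theorem search_table : search table 13 1 [0, 1, 2] 0 = true := by decide +kernel

theorem length_pairs : pairs.length = 191 := by decide +kernel

theorem isCode_pairs : ∀ x ∈ pairs, IsCode x.2 := by decide +kernel

/-- The bound 2 ^ 125 confines a key to 25 digits, for the degrees 0 to 24, so that the face degrees
determine the key. -/
theorem degreesTest_pairs :
    (pairs.all fun x => and (degreesTest x.1 x.2) (Nat.blt x.1 (2 ^ 125))) = true := by
  decide +kernel

theorem separated_pairs : separated pairs = true := by decide +kernel

theorem card_digitList_pairs : (pairs.all fun x => Nat.beq (digitList x.1).length 6) = true := by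
  decide +kernel

theorem exceptional_eq : ((pairs.filter fun x =>
    and (Nat.ble 1 (look x.1 1)) (not (Nat.beq (symmetryType x.2) 1))).map fun x =>
      (x.1, symmetryType x.2)) = exceptional := by
  decide +kernel

theorem count_uniqueFaceDegrees : ∀ p ∈ uniqueFaceDegrees,
    ((pairs.map fun x => (digitList x.1 : Multiset ℕ)) : Multiset (Multiset ℕ)).count p = 1 := by
  decide +kernel

end Dessins

/-! ### The classification -/

namespace Dessins

theorem look_injective {k k' : ℕ} (h : ∀ l, look k l = look k' l) : k = k' := by
  apply Nat.eq_of_testBit_eq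
  intro j
  have key : ∀ n : ℕ, n.testBit j = (look n (j / 5)).testBit (j % 5) := fun n => by
    rw [testBit_look, Nat.div_add_mod, decide_eq_true (Nat.mod_lt j (by norm_num)), Bool.and_true]
  rw [key k, key k', h]

theorem digitList_injective {k k' : ℕ} (hk : k < 2 ^ 125) (hk' : k' < 2 ^ 125)
    (h : (digitList k : Multiset ℕ) = digitList k') : k = k' := by
  have hbig : ∀ n < 2 ^ 125, ∀ l, ¬ l < 25 → look n l = 0 := by
    intro n hn l hl
    apply Nat.eq_of_testBit_eq
    intro i
    rw [testBit_look, Nat.testBit_lt_two_pow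
      (hn.trans_le (Nat.pow_le_pow_right (n := 2) two_pos (by omega)))]
    simp
  refine look_injective fun l => ?_
  have := congrArg (Multiset.count l) h
  rw [Multiset.coe_count, Multiset.coe_count, count_digitList, count_digitList] at this
  by_cases hl : l < 25
  · simpa [hl] using this
  · rw [hbig k hk l hl, hbig k' hk' l hl]

theorem degreesTest_of_mem {x : ℕ × ℕ} (hx : x ∈ pairs) :
    degreesTest x.1 x.2 = true ∧ x.1 < 2 ^ 125 := by
  have := List.all_eq_true.1 degreesTest_pairs x hx
  rwa [Bool.and_eq_true, Nat.blt_eq] at this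

theorem pairwise_of_separated {l : List (ℕ × ℕ)} (h : separated l = true) :
    l.Pairwise fun x y => x.1 ≠ y.1 ∨ ∀ r < 24, isoTest x.2 y.2 r = false := by
  induction l with
  | nil => exact List.Pairwise.nil
  | cons x xs ih =>
    change and (xs.all fun y => bif Nat.beq x.1 y.1 then
      edges.all fun r => not (isoTest x.2 y.2 r) else true) (separated xs) = true at h
    rw [Bool.and_eq_true, List.all_eq_true] at h
    refine List.Pairwise.cons (fun y hy => ?_) (ih h.2)
    have := h.1 y hy
    cases hb : Nat.beq x.1 y.1
    · refine Or.inl fun he => ?_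
      rw [he, Nat.beq_refl] at hb
      exact Bool.noConfusion hb
    · rw [hb, cond_true, List.all_eq_true] at this
      exact Or.inr fun r hr => by simpa using this r (mem_edges.2 hr)

/-- Different keys mean different face degrees; for equal keys all 24 candidate isomorphisms have
been refuted. -/
theorem not_isomorphic_pairs : pairs.Pairwise fun x y => ∀ (hx : x ∈ pairs) (hy : y ∈ pairs),
    ¬ (codeHypermap (isCode_pairs x hx)).Isomorphic (codeHypermap (isCode_pairs y hy)) := by
  refine (pairwise_of_separated separated_pairs).imp ?_
  intro x y h hx hy hiso
  rcases h with h | h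
  · have h1 := hiso.faceDegrees_eq
    rw [faceDegrees_code _ (degreesTest_of_mem hx).1,
      faceDegrees_code _ (degreesTest_of_mem hy).1] at h1
    exact h (digitList_injective (degreesTest_of_mem hx).2 (degreesTest_of_mem hy).2 h1)
  · obtain ⟨r, hr, ht⟩ := exists_isoTest_of_isomorphic _ _ hiso
    rw [h r hr] at ht
    exact Bool.noConfusion ht

theorem eq_of_isomorphic {x y : ℕ × ℕ} (hx : x ∈ pairs) (hy : y ∈ pairs)
    (h : (codeHypermap (isCode_pairs x hx)).Isomorphic (codeHypermap (isCode_pairs y hy))) :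
    x = y := by
  by_contra hne
  have hsymm : Std.Symm fun x y : ℕ × ℕ => ∀ (hx : x ∈ pairs) (hy : y ∈ pairs),
      ¬ (codeHypermap (isCode_pairs x hx)).Isomorphic (codeHypermap (isCode_pairs y hy)) :=
    ⟨fun x y h hy hx hiso => h hx hy hiso.symm⟩
  exact not_isomorphic_pairs.forall hx hy hne hx hy h

theorem nodup_pairs : pairs.Nodup :=
  not_isomorphic_pairs.imp_of_mem fun {x _} hx hy h hxy => by
    subst hxy
    exact h hx hy (Hypermap.Isomorphic.refl _)

/-- The codes in the table. -/
abbrev Rep : Type := {x // x ∈ pairs}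

/-- The hypermap of an element of the table. -/
def Rep.hypermap (x : Rep) : Hypermap := codeHypermap (isCode_pairs x.1 x.2)

theorem Rep.faceDegrees (x : Rep) : x.hypermap.faceDegrees = (digitList x.1.1 : Multiset ℕ) :=
  faceDegrees_code _ (degreesTest_of_mem x.2).1

theorem Rep.exists_subgroup (x : Rep) :
    ∃ Γ : TorsionFreeGenusZero 24, (dessin Γ.group).Isomorphic x.hypermap :=
  exists_subgroup_of_code _ (by
    have h := x.faceDegrees
    rw [Rep.hypermap] at h
    rw [h, Multiset.coe_card]
    exact Nat.eq_of_beq_eq_true (List.all_eq_true.1 card_digitList_pairs x.1 x.2))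

/-- The dessin of an element of the table. -/
noncomputable def Rep.toClass (x : Rep) : DessinClass 24 :=
  Quotient.mk _ x.exists_subgroup.choose

/-- Injectivity is the irredundancy of the table, surjectivity is the exhaustive search. -/
theorem Rep.bijective_toClass : Function.Bijective Rep.toClass := by
  constructor
  · intro x y hxy
    have h1 : (dessin x.exists_subgroup.choose.group).Isomorphic
        (dessin y.exists_subgroup.choose.group) := Quotient.exact hxy
    exact Subtype.ext (eq_of_isomorphic x.2 y.2
      ((x.exists_subgroup.choose_spec.symm.trans h1).trans y.exists_subgroup.choose_spec))
  · intro d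
    induction d using Quotient.inductionOn with | h Γ => ?_
    obtain ⟨q, hq, c, hc, h⟩ := exists_code_of_subgroup search_table Γ
    have hmem : (q.1, c) ∈ pairs :=
      List.mem_flatMap.2 ⟨q, hq, List.mem_map.2 ⟨c, hc, rfl⟩⟩
    let x : Rep := ⟨(q.1, c), hmem⟩
    exact ⟨x, Quotient.sound (x.exists_subgroup.choose_spec.trans (h (isCode_pairs _ hmem)))⟩

theorem Rep.faceDegrees_toClass (x : Rep) :
    x.toClass.faceDegrees = (digitList x.1.1 : Multiset ℕ) :=
  x.exists_subgroup.choose_spec.faceDegrees_eq.trans x.faceDegrees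

theorem Rep.numLoops_toClass (x : Rep) : x.toClass.numLoops = look x.1.1 1 := by
  refine x.exists_subgroup.choose_spec.numLoops_eq.trans ((numLoops_code _).trans ?_)
  change x.hypermap.faceDegrees.count 1 = _
  rw [x.faceDegrees, Multiset.coe_count, count_digitList, if_pos (by norm_num)]

theorem Rep.hasSymmetry_toClass (x : Rep) (A : Type) [Group A] : x.toClass.HasSymmetry A ↔
    Nonempty (codeSymmetries (isCode_pairs x.1 x.2) ≃* A) := by
  obtain ⟨e⟩ := x.exists_subgroup.choose_spec.symmetryGroup_equiv
  exact ⟨fun ⟨f⟩ => ⟨e.symm.trans f⟩, fun ⟨f⟩ => ⟨e.trans f⟩⟩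

theorem symmetryType_eq (c : ℕ) : symmetryType c = if numSymmetries c = 4 then
    (if allSquaresTrivial c = true then 5 else 4)
      else if numSymmetries c ≤ 3 then numSymmetries c else 0 := by
  change (bif Nat.beq (numSymmetries c) 4 then bif allSquaresTrivial c then 5 else 4
    else bif Nat.ble (numSymmetries c) 3 then numSymmetries c else 0) = _
  simp only [cond_eq_ite, Nat.beq_eq, Nat.ble_eq]

theorem Rep.hasSymmetry_unit (x : Rep) :
    x.toClass.HasSymmetry Unit ↔ symmetryType x.1.2 = 1 := by
  rw [x.hasSymmetry_toClass, nonempty_mulEquiv_unit_iff, card_codeSymmetries, symmetryType_eq]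
  split_ifs <;> first | omega | (simp only [iff_false]; omega)

theorem Rep.hasSymmetry_C2 (x : Rep) :
    x.toClass.HasSymmetry (C 2) ↔ symmetryType x.1.2 = 2 := by
  rw [x.hasSymmetry_toClass, nonempty_mulEquiv_C_iff_of_prime, card_codeSymmetries, symmetryType_eq]
  split_ifs <;> first | omega | (simp only [iff_false]; omega)

theorem Rep.hasSymmetry_C3 (x : Rep) :
    x.toClass.HasSymmetry (C 3) ↔ symmetryType x.1.2 = 3 := by
  rw [x.hasSymmetry_toClass, nonempty_mulEquiv_C_iff_of_prime, card_codeSymmetries, symmetryType_eq]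
  split_ifs <;> first | omega | (simp only [iff_false]; omega)

theorem Rep.hasSymmetry_C4 (x : Rep) :
    x.toClass.HasSymmetry (C 4) ↔ symmetryType x.1.2 = 4 := by
  rw [x.hasSymmetry_toClass, nonempty_mulEquiv_C4_iff, card_codeSymmetries,
    ← allSquaresTrivial_iff, symmetryType_eq]
  split_ifs with h1 h2 h3 <;> simp_all

theorem Rep.hasSymmetry_V4 (x : Rep) :
    x.toClass.HasSymmetry V4 ↔ symmetryType x.1.2 = 5 := by
  rw [x.hasSymmetry_toClass, nonempty_mulEquiv_V4_iff, card_codeSymmetries,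
    ← allSquaresTrivial_iff, symmetryType_eq]
  split_ifs with h1 h2 h3 <;> simp_all
  omega

/-- Counting classes of dessins amounts to counting elements of the table. -/
theorem ncard_classes {P : DessinClass 24 → Prop} (p : ℕ × ℕ → Bool)
    (h : ∀ x : Rep, P x.toClass ↔ p x.1 = true) :
    {d | P d}.ncard = (pairs.filter p).length := by
  have h1 : {d | P d} = Rep.toClass '' {x : Rep | p x.1 = true} := by
    ext d
    obtain ⟨x, rfl⟩ := Rep.bijective_toClass.2 d
    rw [Rep.bijective_toClass.1.mem_set_image]
    exact h x
  have h2 : Subtype.val '' {x : Rep | p x.1 = true} = ((pairs.filter p).toFinset : Set (ℕ × ℕ)) := by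
    ext ⟨a, b⟩
    simp [and_comm]
  rw [h1, Set.ncard_image_of_injective _ Rep.bijective_toClass.1,
    ← Set.ncard_image_of_injective _ Subtype.val_injective, h2, Set.ncard_coe_finset,
    List.toFinset_card_of_nodup (nodup_pairs.filter p)]

theorem count_map_digitList (L : List (ℕ × ℕ)) (m : Multiset ℕ) :
    ((L.map fun x => (digitList x.1 : Multiset ℕ)) : Multiset (Multiset ℕ)).count m =
      (L.filter fun x => decide ((digitList x.1 : Multiset ℕ) = m)).length := by
  rw [Multiset.coe_count, List.count, List.countP_map, List.countP_eq_length_filter]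
  congr 2

/-- The codes of the face degrees of the codes with loops and the symmetry type `j`. -/
def exceptionalKeys (j : ℕ) : List (ℕ × ℕ) := exceptional.filter fun y => Nat.beq y.2 j

/-- The list `exceptional` has dropped exactly the entries without loops or with trivial symmetry.
For `j ≠ 1` every count with a loop can therefore be made on its 24 entries, without evaluating
symmetries again. -/
theorem map_filter_exceptional {β : Type} (g : ℕ → β) {j : ℕ} (hj : j ≠ 1) (p : ℕ → Bool) :
    ((pairs.filter fun x => and (Nat.ble 1 (look x.1 1)) (and (Nat.beq (symmetryType x.2) j)
      (p x.1))).map fun x => g x.1) =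
      ((exceptionalKeys j).filter fun y => p y.1).map fun y => g y.1 := by
  rw [exceptionalKeys, ← exceptional_eq, List.filter_map, List.filter_map, List.filter_filter,
    List.filter_filter, List.map_map]
  congr 1
  refine List.filter_congr fun x _ => ?_
  simp only [Function.comp_apply]
  cases h : Nat.beq (symmetryType x.2) j
  · simp
  · have h1 : Nat.beq (symmetryType x.2) 1 = false := by
      rw [Nat.eq_of_beq_eq_true h]
      cases h2 : Nat.beq j 1
      · rfl
      · exact absurd (Nat.eq_of_beq_eq_true h2) hj
    rw [h1]
    cases Nat.ble 1 (look x.1 1) <;> cases p x.1 <;> rfl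

section Table

variable {A : Type} [Group A] {j : ℕ}

theorem ncard_table (hj : j ≠ 1)
    (hA : ∀ x : Rep, x.toClass.HasSymmetry A ↔ symmetryType x.1.2 = j) {l : ℕ} (hl : 1 ≤ l)
    (m : Multiset ℕ) :
    {d : DessinClass 24 | d.numLoops = l ∧ d.faceDegrees = m ∧ d.HasSymmetry A}.ncard =
      ((((exceptionalKeys j).filter fun y => Nat.beq (look y.1 1) l).map
        fun y => (digitList y.1 : Multiset ℕ)) : Multiset (Multiset ℕ)).count m := by
  rw [← map_filter_exceptional (fun k => (digitList k : Multiset ℕ)) hj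
    (fun k => Nat.beq (look k 1) l), count_map_digitList, List.filter_filter]
  refine ncard_classes _ fun x => ?_
  rw [x.numLoops_toClass, x.faceDegrees_toClass, hA]
  simp only [Bool.and_eq_true, decide_eq_true_eq, Nat.ble_eq, Nat.beq_eq]
  constructor
  · rintro ⟨h1, h2, h3⟩
    exact ⟨h2, by omega, h3, h1⟩
  · rintro ⟨h1, -, h2, h3⟩
    exact ⟨h3, h1, h2⟩

theorem ncard_loops_eq (hj : j ≠ 1)
    (hA : ∀ x : Rep, x.toClass.HasSymmetry A ↔ symmetryType x.1.2 = j) {l : ℕ} (hl : 1 ≤ l) :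
    {d : DessinClass 24 | d.numLoops = l ∧ d.HasSymmetry A}.ncard =
      ((exceptionalKeys j).filter fun y => Nat.beq (look y.1 1) l).length := by
  have h := congrArg List.length (map_filter_exceptional id hj (fun k => Nat.beq (look k 1) l))
  rw [List.length_map, List.length_map] at h
  rw [← h]
  refine ncard_classes _ fun x => ?_
  rw [x.numLoops_toClass, hA]
  simp only [Bool.and_eq_true, Nat.ble_eq, Nat.beq_eq]
  constructor
  · rintro ⟨h1, h2⟩
    exact ⟨by omega, h2, h1⟩
  · rintro ⟨-, h1, h2⟩
    exact ⟨h2, h1⟩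

theorem ncard_one_le_loops (hj : j ≠ 1)
    (hA : ∀ x : Rep, x.toClass.HasSymmetry A ↔ symmetryType x.1.2 = j) :
    {d : DessinClass 24 | 1 ≤ d.numLoops ∧ d.HasSymmetry A}.ncard = (exceptionalKeys j).length := by
  have h := congrArg List.length (map_filter_exceptional id hj (fun _ => true))
  rw [List.length_map, List.length_map, List.filter_true] at h
  rw [← h]
  refine ncard_classes _ fun x => ?_
  rw [x.numLoops_toClass, hA]
  simp only [Bool.and_eq_true, Nat.ble_eq, Nat.beq_eq, and_true]

end Table

/-- The face degrees of the codes with `l` loops and the symmetry type `j`. -/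
def exceptionalDegrees (j l : ℕ) : Multiset (Multiset ℕ) :=
  (((exceptionalKeys j).filter fun y => Nat.beq (look y.1 1) l).map
    fun y => (digitList y.1 : Multiset ℕ))

/-- This covers the infinitely many loop numbers for which the stated tables are empty. -/
theorem exceptionalDegrees_of_notMem {j l : ℕ} (s : List ℕ)
    (h : ∀ y ∈ exceptionalKeys j, look y.1 1 ∈ s) (hl : l ∉ s) : exceptionalDegrees j l = 0 := by
  rw [exceptionalDegrees, List.filter_eq_nil_iff.2, List.map_nil, Multiset.coe_nil]
  intro y hy hb
  exact hl (Nat.eq_of_beq_eq_true hb ▸ h y hy)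

theorem exceptionalDegrees_two (l : ℕ) : exceptionalDegrees 2 l = tableC2 l := by
  unfold tableC2
  split
  · decide +kernel
  · decide +kernel
  · exact exceptionalDegrees_of_notMem [2, 4] (by decide +kernel) (by simp_all)

theorem exceptionalDegrees_three (l : ℕ) : exceptionalDegrees 3 l = tableC3 l := by
  unfold tableC3
  split
  · decide +kernel
  · exact exceptionalDegrees_of_notMem [3] (by decide +kernel) (by simp_all)

theorem exceptionalDegrees_four (l : ℕ) : exceptionalDegrees 4 l = tableC4 l := by
  unfold tableC4
  split
  · decide +kernel
  · exact exceptionalDegrees_of_notMem [4] (by decide +kernel) (by simp_all)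

theorem exceptionalDegrees_five (l : ℕ) : exceptionalDegrees 5 l = tableV4 l := by
  unfold tableV4
  split
  · decide +kernel
  · exact exceptionalDegrees_of_notMem [4] (by decide +kernel) (by simp_all)

/-- The type 0, which stands for larger groups, is excluded because every entry with a loop and type
other than 1 occurs in `exceptional`, where only the types 2 to 5 appear. -/
theorem symmetryType_of_loops {x : ℕ × ℕ} (hx : x ∈ pairs) (hl : 1 ≤ look x.1 1) :
    symmetryType x.2 = 1 ∨ symmetryType x.2 = 2 ∨ symmetryType x.2 = 3 ∨
      symmetryType x.2 = 4 ∨ symmetryType x.2 = 5 := by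
  by_cases h1 : symmetryType x.2 = 1
  · exact Or.inl h1
  · have hmem : (x.1, symmetryType x.2) ∈ exceptional := by
      rw [← exceptional_eq]
      refine List.mem_map.2 ⟨x, List.mem_filter.2 ⟨hx, ?_⟩, rfl⟩
      rw [Bool.and_eq_true, Nat.ble_eq, Bool.not_eq_true', ← Bool.not_eq_true, Nat.beq_eq]
      exact ⟨hl, h1⟩
    have hall : ∀ y ∈ exceptional, y.2 = 2 ∨ y.2 = 3 ∨ y.2 = 4 ∨ y.2 = 5 := by decide +kernel
    exact Or.inr (hall _ hmem)

theorem card_dessinClass : Nat.card (DessinClass 24) = 191 := by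
  rw [← Nat.card_congr (Equiv.ofBijective _ Rep.bijective_toClass), ← length_pairs,
    ← List.toFinset_card_of_nodup nodup_pairs, ← Nat.card_eq_finsetCard]
  exact Nat.card_congr (Equiv.subtypeEquivRight fun x => List.mem_toFinset.symm)

theorem ncard_uniqueFaceDegrees {p : Multiset ℕ} (hp : p ∈ uniqueFaceDegrees) :
    {d : DessinClass 24 | d.faceDegrees = p}.ncard = 1 := by
  rw [← count_uniqueFaceDegrees p hp, count_map_digitList]
  refine ncard_classes _ fun x => ?_
  rw [x.faceDegrees_toClass, decide_eq_true_eq]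

end Dessins

theorem mainTheorem12 :
    -- there are 191 dessins
    Nat.card (Dessins.DessinClass 24) = 191 ∧
    -- the possible symmetry groups of the dessins with at least one loop
    (∀ d : Dessins.DessinClass 24, 1 ≤ d.numLoops →
      d.HasSymmetry Unit ∨ d.HasSymmetry (Dessins.C 2) ∨ d.HasSymmetry (Dessins.C 3) ∨
        d.HasSymmetry Dessins.V4 ∨ d.HasSymmetry (Dessins.C 4)) ∧
    -- the table: the dessins with a non-trivial symmetry group, by loops and face degrees
    (∀ l : ℕ, 1 ≤ l → ∀ p : Multiset ℕ,
      {d : Dessins.DessinClass 24 | d.numLoops = l ∧ d.faceDegrees = p ∧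
        d.HasSymmetry (Dessins.C 2)}.ncard = (Dessins.tableC2 l).count p ∧
      {d : Dessins.DessinClass 24 | d.numLoops = l ∧ d.faceDegrees = p ∧
        d.HasSymmetry (Dessins.C 3)}.ncard = (Dessins.tableC3 l).count p ∧
      {d : Dessins.DessinClass 24 | d.numLoops = l ∧ d.faceDegrees = p ∧
        d.HasSymmetry Dessins.V4}.ncard = (Dessins.tableV4 l).count p ∧
      {d : Dessins.DessinClass 24 | d.numLoops = l ∧ d.faceDegrees = p ∧
        d.HasSymmetry (Dessins.C 4)}.ncard = (Dessins.tableC4 l).count p) ∧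
    -- face degrees that determine the dessin
    (∀ p ∈ Dessins.uniqueFaceDegrees,
      {d : Dessins.DessinClass 24 | d.faceDegrees = p}.ncard = 1) ∧
    -- the totals
    {d : Dessins.DessinClass 24 | d.numLoops = 2 ∧ d.HasSymmetry (Dessins.C 2)}.ncard = 18 ∧
    {d : Dessins.DessinClass 24 | d.numLoops = 4 ∧ d.HasSymmetry (Dessins.C 2)}.ncard = 3 ∧
    {d : Dessins.DessinClass 24 | 1 ≤ d.numLoops ∧ d.HasSymmetry (Dessins.C 2)}.ncard = 21 ∧
    {d : Dessins.DessinClass 24 | 1 ≤ d.numLoops ∧ d.HasSymmetry (Dessins.C 3)}.ncard = 1 ∧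
    {d : Dessins.DessinClass 24 | 1 ≤ d.numLoops ∧ d.HasSymmetry Dessins.V4}.ncard = 1 ∧
    {d : Dessins.DessinClass 24 | 1 ≤ d.numLoops ∧ d.HasSymmetry (Dessins.C 4)}.ncard = 1 := by
  open Dessins in
  refine ⟨card_dessinClass, fun d hd => ?_, fun l hl p => ⟨?_, ?_, ?_, ?_⟩,
    fun p hp => ncard_uniqueFaceDegrees hp, ?_, ?_, ?_, ?_, ?_, ?_⟩
  · obtain ⟨x, rfl⟩ := Rep.bijective_toClass.2 d
    rw [x.numLoops_toClass] at hd
    rw [x.hasSymmetry_unit, x.hasSymmetry_C2, x.hasSymmetry_C3, x.hasSymmetry_V4, x.hasSymmetry_C4]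
    have := symmetryType_of_loops x.2 hd
    tauto
  · rw [← exceptionalDegrees_two]
    exact ncard_table (by norm_num) Rep.hasSymmetry_C2 hl p
  · rw [← exceptionalDegrees_three]
    exact ncard_table (by norm_num) Rep.hasSymmetry_C3 hl p
  · rw [← exceptionalDegrees_five]
    exact ncard_table (by norm_num) Rep.hasSymmetry_V4 hl p
  · rw [← exceptionalDegrees_four]
    exact ncard_table (by norm_num) Rep.hasSymmetry_C4 hl p
  · rw [ncard_loops_eq (by norm_num) Rep.hasSymmetry_C2 (by norm_num)]
    decide +kernel
  · rw [ncard_loops_eq (by norm_num) Rep.hasSymmetry_C2 (by norm_num)]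
    decide +kernel
  · rw [ncard_one_le_loops (by norm_num) Rep.hasSymmetry_C2]
    decide +kernel
  · rw [ncard_one_le_loops (by norm_num) Rep.hasSymmetry_C3]
    decide +kernel
  · rw [ncard_one_le_loops (by norm_num) Rep.hasSymmetry_V4]
    decide +kernel
  · rw [ncard_one_le_loops (by norm_num) Rep.hasSymmetry_C4]
    decide +kernel
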